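/- Let $C\subset\mathbb R^2$ be an open planar cone of any opening angle $\alpha\in(0,2\pi]$, i.e. $C=\{a+r(\cos t,\sin t): r>0,\ \beta<t<\beta+\alpha\}$ for some $a\in\mathbb R^2$, $\beta\in\mathbb R$. Let $\Omega\subset C$ be a bounded domain, let $R\subset\partial\Omega$ be contained in $\partial C$, and let $E=\partial\Omega\setminus R$. Assume that $\Omega$ has an outer unit normal at all but countably many points of $R$ (the exceptional points being corners, such as the vertex of the cone). Here a unit vector $\nu$ is called the outer unit normal of $\Omega$ at $p\in\partial\Omega$ if for every $\varepsilon>0$ all points $x$ sufficiently close to $p$ satisfy: $x\in\Omega$ if $\langle \nu,x-p\rangle<-\varepsilon|x-p|$, and $x\notin\Omega$ if $\langle\nu,x-p\rangle>\varepsilon|x-p|$. A broken ray is a piecewise linear curve $\gamma:[0,L]\to\overline\Omega$ ($0<L<\infty$, finitely many linear pieces) of unit speed with both endpoints on $E$ which is straight in $\Omega$ and which at every time $s\in(0,L)$ with $\gamma(s)\in\partial\Omega$ obeys the reflection law $v_o=v_i-2\langle\nu,v_i\rangle\nu$, where $v_i,v_o$ are the incoming and outgoing directions and $\nu$ is the outer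 unit normal of $\Omega$ at $\gamma(s)$ (thus a broken ray must reflect on $R$, it may reflect or stop on $E$, and reflections may be tangential). The broken ray transform of $f$ is $\mathcal Gf(\gamma)=\int_0^L f(\gamma(t))\,dt$, defined for those broken rays along which $f$ is integrable. A function $f:\overline\Omega\to\mathbb R$ is piecewise continuous if there are finitely many pairwise disjoint open sets $U_1,\dots,U_n\subset\Omega$ that cover $\Omega$ up to a set of measure zero, such that each $f|_{U_i}$ extends continuously to $\overline{U_i}$. Then the broken ray transform is injective on piecewise continuous functions: if $f,g:\overline\Omega\to\mathbb R$ are piecewise continuous and $\mathcal Gf(\gamma)=\mathcal Gg(\gamma)$ for every broken ray $\gamma$ along which both are integrable, then $f=g$ almost everywhere in $\Omega$, and $f(x)=g(x)$ at every point $x\in\overline\Omega$ at which both $f$ and $g$ are continuous (as functions on $\overline\Omega$). -/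

import Mathlib

open Set Filter Topology MeasureTheory

/-- The open planar cone (sector) with vertex `a` and opening angle `α`, whose sides leave `a` in the
directions `exp (β i)` and `exp ((β + α) i)`. The Euclidean plane is `ℂ`. -/
def planarCone (a : ℂ) (β α : ℝ) : Set ℂ :=
  {z | ∃ r t : ℝ, 0 < r ∧ β < t ∧ t < β + α ∧
    z = a + (r : ℂ) * Complex.exp ((t : ℂ) * Complex.I)}

/-- `ν` is the outer unit normal of `Ω` at the boundary point `p`: near `p`, inside any two-sided
sector around the line through `p` parallel to `ν`, the set `Ω` lies exactly on the side of `-ν`.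
At a point where the boundary is a `C¹` curve with `Ω` on one side this is the usual outer unit
normal; at a corner no such `ν` exists. -/
def IsOuterUnitNormal (Ω : Set ℂ) (p ν : ℂ) : Prop :=
  p ∈ frontier Ω ∧ ‖ν‖ = 1 ∧ ∀ ε : ℝ, 0 < ε → ∀ᶠ x in 𝓝 p,
    (inner ℝ ν (x - p) < -(ε * ‖x - p‖) → x ∈ Ω) ∧
    (ε * ‖x - p‖ < inner ℝ ν (x - p) → x ∉ Ω)

/-- `γ : [0, L] → closure Ω` is a broken ray for the reflecting set `R ⊆ frontier Ω`; the set of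
tomography is `E = frontier Ω \ R`. The curve is piecewise linear with unit speed, has its endpoints
on `E`, is straight inside `Ω`, and obeys the reflection law at every boundary point that it meets at
a time strictly between `0` and `L` (so it has to reflect on `R`, and on `E` it reflects or stops).
Tangential reflections are allowed and leave the direction unchanged. -/
structure IsBrokenRay (Ω R : Set ℂ) (L : ℝ) (γ : ℝ → ℂ) : Prop where
  length_pos : 0 < L
  mem_closure : ∀ t ∈ Icc 0 L, γ t ∈ closure Ω
  start_mem : γ 0 ∈ frontier Ω \ R
  end_mem : γ L ∈ frontier Ω \ R
  piecewise_linear : ∃ B : Set ℝ, B.Finite ∧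
    ∀ a b : ℝ, 0 ≤ a → a < b → b ≤ L → Disjoint (Ioo a b) B →
      ∃ v : ℂ, ‖v‖ = 1 ∧ ∀ t ∈ Icc a b, γ t = γ a + (t - a) • v
  reflection : ∀ s ∈ Ioo 0 L, ∃ vi vo : ℂ,
    HasDerivWithinAt γ vi (Iic s) s ∧ HasDerivWithinAt γ vo (Ici s) s ∧
    (γ s ∈ Ω → vo = vi) ∧
    (γ s ∈ frontier Ω →
      ∃ ν : ℂ, IsOuterUnitNormal Ω (γ s) ν ∧ vo = vi - (2 * inner ℝ ν vi) • ν)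

/-- The value of the broken ray transform of `f` on `γ : [0, L] → closure Ω`. It is meaningful when
`f` is integrable along `γ`. -/
noncomputable def brokenRayTransform (f : ℂ → ℝ) (L : ℝ) (γ : ℝ → ℂ) : ℝ :=
  ∫ t in (0 : ℝ)..L, f (γ t)

/-- `f` is integrable along `γ : [0, L] → closure Ω`. -/
def IntegrableAlong (f : ℂ → ℝ) (L : ℝ) (γ : ℝ → ℂ) : Prop :=
  IntervalIntegrable (fun t => f (γ t)) volume 0 L

/-- `f` is piecewise continuous on `Ω`: up to a set of measure zero, `Ω` is the union of finitely
many pairwise disjoint open pieces, and on each piece `f` agrees with a function that is continuous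
up to the boundary of the piece. -/
def IsPiecewiseContinuous (f : ℂ → ℝ) (Ω : Set ℂ) : Prop :=
  ∃ (n : ℕ) (U : Fin n → Set ℂ),
    (∀ i, IsOpen (U i)) ∧ (∀ i, U i ⊆ Ω) ∧ Pairwise (fun i j => Disjoint (U i) (U j)) ∧
    volume (Ω \ ⋃ i, U i) = 0 ∧
    ∀ i, ∃ g : ℂ → ℝ, ContinuousOn g (closure (U i)) ∧ EqOn f g (U i)

/-! Unfolding. A billiard trajectory in a sector of angle `α`, reflected at its sides, lifts to a
straight line in the cone obtained by doubling the sector, whose total angle is `2α`. In polar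
coordinates a line at distance `d > 0` from the vertex is `s ↦ (√(d² + s²), x + arctan (s / d))`.
Composing the angle with a triangle wave folds it back (`foldedLine`). Only finitely many sides are
met, never the vertex, and no arithmetic condition on `α` is needed.

The times that a folded line spends in `Ω`, or on `R` coming from `Ω`, form a bounded open set: at a
point of `R` with a normal the line bounces back into `Ω`. The components of this set are broken
rays (`isBrokenRay_foldedLine`). Hence the difference `h` of `f` and `g`, cut off to a set of full
measure where both are continuous and bounded, integrates to zero along the whole folded line
(`integral_foldedLine_eq_zero`). For almost every `d` and `x` the line avoids the countably many
corners in `R` and meets the discarded null set only in a null set of times.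

It remains to invert the X-ray transform on a cone of angle `T = 2α`
(`ae_eq_zero_of_xray_cone_eq_zero`). Rotation invariance decouples the angular Fourier coefficients
`A` of the lifted function: `∫ A(√(d² + s²)) exp(-i l arctan (s / d)) ds = 0` for almost every `d >
0`. Multiplying by `dⁿ`, integrating over `d` and passing to polar coordinates in the `(d, s)`
half-plane splits this into `(∫ rⁿ⁺¹ A(r) dr) (∫ cosⁿ φ exp(-i l φ) dφ) = 0`. The second factor is
nonzero for large `n`, so all high moments of `A` vanish. By Weierstrass approximation `A = 0`, and
by Parseval the lifted function vanishes almost everywhere. -/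

/-! ### Moments and Fourier coefficients on an interval. -/

/-- High powers of the cosine concentrate at `0`, so that all their fixed Fourier-type integrals are
eventually nonzero. -/
theorem eventually_integral_cos_pow_mul_exp_ne_zero (l : ℝ) :
    ∀ᶠ n : ℕ in atTop, (∫ φ in Icc (-(Real.pi / 2)) (Real.pi / 2),
      (Real.cos φ ^ n) • Complex.exp (l * φ * Complex.I)) ≠ 0 := by
  have hpi := Real.pi_pos
  have h := tendsto_setIntegral_pow_smul_of_unique_maximum_of_isCompact_of_continuousOn
    (μ := (volume : Measure ℝ)) (x₀ := 0) (s := Icc (-(Real.pi / 2)) (Real.pi / 2))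
    (c := Real.cos) (g := fun φ : ℝ => Complex.exp (l * φ * Complex.I)) isCompact_Icc
    Real.continuous_cos.continuousOn ?_ ?_ (by simp) ?_ (by fun_prop)
  -- Divided by the mass of `cosⁿ`, the integrals tend to the value of the exponential at `0`, which
  -- is `1`.
  · have h1 := h.eventually_ne (b₂ := 0) (by simp)
    filter_upwards [h1] with n hn h0
    exact hn (by rw [h0, smul_zero])
  · intro y hy hy0
    rw [Real.cos_zero]
    refine lt_of_le_of_ne (Real.cos_le_one y) fun h1 => hy0 ?_
    exact (Real.cos_eq_one_iff_of_lt_of_lt (by linarith [hy.1]) (by linarith [hy.2])).1 h1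
  · intro x hx
    exact Real.cos_nonneg_of_mem_Icc hx
  · rw [interior_Icc]
    exact subset_closure ⟨by linarith, by linarith⟩

/-- A function on a bounded interval all of whose high moments vanish is zero. -/
theorem ae_eq_zero_of_moments_eq_zero {M : ℝ} {N : ℕ} {b : ℝ → ℂ} (hb : IntegrableOn b (Ioc 0 M))
    (h : ∀ n ≥ N, ∫ r in Ioc 0 M, ((r ^ n : ℝ) : ℂ) * b r = 0) :
    ∀ᵐ r, r ∈ Ioo 0 M → b r = 0 := by
  have hint : ∀ g : ℝ → ℝ, Continuous g → IntegrableOn (fun r => (g r : ℂ) * b r) (Ioc 0 M) := by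
    intro g hg
    have h1 := IntegrableOn.continuousOn_mul_of_subset (g := fun r => (g r : ℂ)) (g' := b) (μ := volume)
      (K := Icc 0 M) (A := Ioc 0 M)
      (by fun_prop) hb isCompact_Icc measurableSet_Ioc Ioc_subset_Icc_self
    exact h1
  have hpoly : ∀ p : Polynomial ℝ, ∫ r in Ioc 0 M, ((r ^ N * p.eval r : ℝ) : ℂ) * b r = 0 := by
    intro p
    induction p using Polynomial.induction_on' with
    | add p q hp hq =>
      have : (fun r : ℝ => ((r ^ N * (p + q).eval r : ℝ) : ℂ) * b r) = fun r =>
        ((r ^ N * p.eval r : ℝ) : ℂ) * b r + ((r ^ N * q.eval r : ℝ) : ℂ) * b r := by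
        ext r; rw [Polynomial.eval_add]; push_cast; ring
      rw [this, integral_add, hp, hq, add_zero]
      · exact hint _ (by fun_prop)
      · exact hint _ (by fun_prop)
    | monomial n c =>
      have : (fun r : ℝ => ((r ^ N * (Polynomial.monomial n c).eval r : ℝ) : ℂ) * b r) = fun r =>
        (c : ℂ) * (((r ^ (N + n) : ℝ) : ℂ) * b r) := by
        ext r; rw [Polynomial.eval_monomial]; push_cast; ring
      rw [this, integral_const_mul, h _ (by lia), mul_zero]
  -- Weierstrass approximation of `g`; the weight `r ^ N` means that only moments of order at least
  -- `N` enter.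
  have hcont : ∀ g : ℝ → ℝ, Continuous g → ∫ r in Ioc 0 M, ((r ^ N * g r : ℝ) : ℂ) * b r = 0 := by
    intro g hg
    have hI : IntegrableOn (fun r : ℝ => ((r ^ N : ℝ) : ℂ) * b r) (Ioc 0 M) := hint _ (by fun_prop)
    set K := ∫ r in Ioc 0 M, ‖((r ^ N : ℝ) : ℂ) * b r‖ with hK
    have hK0 : 0 ≤ K := integral_nonneg fun _ => norm_nonneg _
    have key : ∀ ε > 0, ‖∫ r in Ioc 0 M, ((r ^ N * g r : ℝ) : ℂ) * b r‖ ≤ ε * K := by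
      intro ε hε
      obtain ⟨p, hp⟩ := exists_polynomial_near_of_continuousOn 0 M g hg.continuousOn ε hε
      have h1 : ∫ r in Ioc 0 M, ((r ^ N * g r : ℝ) : ℂ) * b r =
          ∫ r in Ioc 0 M, ((g r - p.eval r : ℝ) : ℂ) * (((r ^ N : ℝ) : ℂ) * b r) := by
        rw [← sub_zero (∫ r in Ioc 0 M, ((r ^ N * g r : ℝ) : ℂ) * b r), ← hpoly p,
          ← integral_sub (hint _ (by fun_prop)) (hint _ (by fun_prop))]
        congr 1; ext r; push_cast; ring
      rw [h1, hK, ← integral_const_mul]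
      refine norm_integral_le_of_norm_le (hI.norm.const_mul ε) ?_
      refine (ae_restrict_iff' measurableSet_Ioc).2 (Eventually.of_forall fun r hr => ?_)
      rw [norm_mul, Complex.norm_real, Real.norm_eq_abs, abs_sub_comm]
      exact mul_le_mul_of_nonneg_right (hp r (Ioc_subset_Icc_self hr)).le (norm_nonneg _)
    rw [← norm_le_zero_iff]
    refine le_of_forall_pos_le_add fun δ hδ => ?_
    refine (key (δ / (K + 1)) (by positivity)).trans ?_
    rw [zero_add, div_mul_eq_mul_div, div_le_iff₀ (by positivity)]
    nlinarith
  have h0 := isOpen_Ioo.ae_eq_zero_of_integral_contDiff_smul_eq_zero (U := Ioo 0 M)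
    (f := fun r : ℝ => ((r ^ N : ℝ) : ℂ) * b r) (μ := volume)
    ((((hint (fun r => r ^ N) (by fun_prop)).mono_set Ioo_subset_Ioc_self)).locallyIntegrableOn) ?_
  · filter_upwards [h0] with r hr hrM
    have := hr hrM
    simpa [hrM.1.ne'] using this
  · intro g hg _ hgs
    have h1 : ∀ r, r ∉ Ioc 0 M → g r • (((r ^ N : ℝ) : ℂ) * b r) = 0 := by
      intro r hr
      have : r ∉ tsupport g := fun h => hr (Ioo_subset_Ioc_self (hgs h))
      rw [image_eq_zero_of_notMem_tsupport this, zero_smul]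
    rw [← setIntegral_eq_integral_of_forall_compl_eq_zero h1, ← hcont g hg.continuous]
    congr 1; ext r; rw [Complex.real_smul]; push_cast; ring

/-- A bounded function on an interval with vanishing Fourier coefficients is zero. -/
theorem ae_eq_zero_of_fourier_integrals_eq_zero {T C : ℝ} (hT : 0 < T) {u : ℝ → ℂ}
    (hu : Measurable u) (hC : ∀ x, ‖u x‖ ≤ C)
    (h : ∀ k : ℤ, ∫ x in 0..T, Complex.exp (((2 * Real.pi * k / T : ℝ) : ℂ) * x * Complex.I) * u x = 0) :
    ∀ᵐ x, x ∈ Ioc 0 T → u x = 0 := by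
  have hL2 : MemLp u 2 (volume.restrict (Ioc 0 T)) :=
    MemLp.of_bound hu.aestronglyMeasurable C (Eventually.of_forall hC)
  -- Parseval turns vanishing coefficients into vanishing `L²` norm.
  have hs := hasSum_sq_fourierCoeffOn hT hL2
  have hz : ∀ k : ℤ, fourierCoeffOn hT u k = 0 := by
    intro k
    rw [fourierCoeffOn_eq_integral]
    have : ∀ x : ℝ, fourier (-k) (x : AddCircle (T - 0)) • u x =
        Complex.exp (((2 * Real.pi * (-k : ℤ) / T : ℝ) : ℂ) * x * Complex.I) * u x := by
      intro x
      rw [fourier_coe_apply, smul_eq_mul]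
      congr 2
      push_cast
      ring
    simp_rw [this, h (-k), smul_zero]
  simp only [hz, norm_zero, ne_eq, OfNat.ofNat_ne_zero, not_false_eq_true, zero_pow] at hs
  have h1 := hs.unique hasSum_zero
  have h2 : ∫ x in 0..T, ‖u x‖ ^ 2 = 0 := by
    have hT' : T⁻¹ ≠ 0 := inv_ne_zero hT.ne'
    simpa [hT.ne'] using h1
  rw [intervalIntegral.integral_of_le hT.le,
    integral_eq_zero_iff_of_nonneg (fun _ => by positivity) hL2.integrable_norm_pow'] at h2
  rw [← ae_restrict_iff' measurableSet_Ioc]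
  filter_upwards [h2] with x hx
  simpa using hx

/-! ### The X-ray transform on a cone of total angle `T`. -/

/-- The unnormalized angular Fourier coefficient of frequency `l` of a function given in polar
coordinates with angular period `T`. -/
noncomputable def angularCoeff (H : ℝ → ℝ → ℝ) (T l r : ℝ) : ℂ :=
  ∫ x in 0..T, Complex.exp (l * x * Complex.I) * H r x

section angularCoeff

variable {H : ℝ → ℝ → ℝ} {T C M l : ℝ}

theorem norm_exp_ofReal_mul_ofReal_mul_I (l x : ℝ) : ‖Complex.exp (l * x * Complex.I)‖ = 1 := by
  rw [← Complex.ofReal_mul, Complex.norm_exp_ofReal_mul_I]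

theorem measurable_angularCoeff (hT : 0 < T) (hH : Measurable (Function.uncurry H)) :
    Measurable (angularCoeff H T l) := by
  unfold angularCoeff
  simp_rw [intervalIntegral.integral_of_le hT.le]
  refine (StronglyMeasurable.integral_prod_right
    (f := fun r (x : ℝ) => Complex.exp (l * x * Complex.I) * H r x) ?_).measurable
  refine Measurable.stronglyMeasurable ?_
  have h1 : Measurable fun p : ℝ × ℝ => ((H p.1 p.2 : ℝ) : ℂ) := Complex.measurable_ofReal.comp hH
  exact Measurable.mul (by fun_prop) h1

theorem norm_angularCoeff_le (hT : 0 < T) (hC : ∀ r x, |H r x| ≤ C) (r : ℝ) :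
    ‖angularCoeff H T l r‖ ≤ C * T := by
  have := intervalIntegral.norm_integral_le_of_norm_le_const (a := 0) (b := T) (C := C)
    (f := fun x : ℝ => Complex.exp (l * x * Complex.I) * H r x) (fun x _ => by
      rw [norm_mul, norm_exp_ofReal_mul_ofReal_mul_I, one_mul, Complex.norm_real]
      exact hC r x)
  rwa [sub_zero, abs_of_pos hT] at this

theorem angularCoeff_eq_zero (hM : ∀ r x, M < r → H r x = 0) {r : ℝ} (hr : M < r) :
    angularCoeff H T l r = 0 := by
  simp [angularCoeff, hM _ _ hr]

/-- Rotation multiplies an angular coefficient by a phase: `hl` makes the whole integrand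
`T`-periodic, so the window of integration can be shifted. -/
theorem integral_exp_mul_comp_add (hper : ∀ r, Function.Periodic (H r) T)
    (hl : Complex.exp (l * T * Complex.I) = 1) (r φ : ℝ) :
    ∫ x in 0..T, Complex.exp (l * x * Complex.I) * H r (x + φ) =
      Complex.exp (l * (-φ : ℝ) * Complex.I) * angularCoeff H T l r := by
  set G : ℝ → ℂ := fun x => Complex.exp (l * (x - φ : ℝ) * Complex.I) * H r x with hG
  have hGper : Function.Periodic G T := by
    intro x
    have : (l * (x + T - φ : ℝ) * Complex.I : ℂ) =
        l * (x - φ : ℝ) * Complex.I + l * T * Complex.I := by push_cast; ring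
    simp only [hG, hper r x, this, Complex.exp_add, hl, mul_one]
  have h1 : ∀ x : ℝ, Complex.exp (l * x * Complex.I) * H r (x + φ) = G (x + φ) := by
    intro x; simp only [hG, add_sub_cancel_right]
  simp_rw [h1]
  rw [intervalIntegral.integral_comp_add_right, zero_add, add_comm T φ,
    hGper.intervalIntegral_add_eq φ 0, zero_add, angularCoeff, ← intervalIntegral.integral_const_mul]
  congr 1; ext x
  simp only [hG]
  rw [← mul_assoc, ← Complex.exp_add]
  congr 2
  push_cast; ring

/-- One integral over the half-plane `d > 0` is computed twice: by lines of constant `d` it vanishes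
by `hX`, and in polar coordinates it is the product. The extra power of `r` is the Jacobian. -/
theorem moment_angularCoeff_mul_eq_zero (hT : 0 < T) (hH : Measurable (Function.uncurry H))
    (hC : ∀ r x, |H r x| ≤ C) (hM : ∀ r x, M < r → H r x = 0)
    (hper : ∀ r, Function.Periodic (H r) T) (hl : Complex.exp (l * T * Complex.I) = 1)
    (hX : ∀ᵐ d : ℝ, 0 < d → ∀ᵐ x : ℝ,
      ∫ s : ℝ, H √(d ^ 2 + s ^ 2) (x + Real.arctan (s / d)) = 0) (n : ℕ) :
    (∫ r in Ioi 0, ((r ^ (n + 1) : ℝ) : ℂ) * angularCoeff H T l r) *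
      (∫ φ in Icc (-(Real.pi / 2)) (Real.pi / 2),
        (Real.cos φ ^ n) • Complex.exp ((-l : ℝ) * φ * Complex.I)) = 0 := by
  have hpi := Real.pi_pos
  have hC0 : 0 ≤ C := (abs_nonneg _).trans (hC 0 0)
  set A := angularCoeff H T l with hA
  have hAm : Measurable A := measurable_angularCoeff hT hH
  -- The value `0` for `d ≤ 0` restricts the polar angle to `(-π/2, π/2)`, where `arctan (s / d)` is
  -- the angle itself.
  set F : ℝ × ℝ → ℂ := fun p => if 0 < p.1 then
    ((p.1 ^ n : ℝ) : ℂ) * (Complex.exp (l * (-Real.arctan (p.2 / p.1) : ℝ) * Complex.I) *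
      A √(p.1 ^ 2 + p.2 ^ 2)) else 0 with hF
  have hFm : Measurable F := by
    refine Measurable.ite (measurableSet_lt measurable_const measurable_fst) ?_ measurable_const
    have : Measurable fun p : ℝ × ℝ => A √(p.1 ^ 2 + p.2 ^ 2) := hAm.comp (by fun_prop)
    fun_prop
  have hle1 : ∀ d s : ℝ, |d| ≤ √(d ^ 2 + s ^ 2) := fun d s => by
    rw [← Real.sqrt_sq_eq_abs]; exact Real.sqrt_le_sqrt (by nlinarith [sq_nonneg s])
  have hle2 : ∀ d s : ℝ, |s| ≤ √(d ^ 2 + s ^ 2) := fun d s => by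
    rw [← Real.sqrt_sq_eq_abs]; exact Real.sqrt_le_sqrt (by nlinarith [sq_nonneg d])
  have hFsupp : Function.support F ⊆ Icc (-M) M ×ˢ Icc (-M) M := by
    intro p hp
    by_contra hcon
    refine hp ?_
    have : M < √(p.1 ^ 2 + p.2 ^ 2) := by
      by_contra! hle
      exact hcon ⟨abs_le.1 ((hle1 _ _).trans hle), abs_le.1 ((hle2 _ _).trans hle)⟩
    simp only [hF, hA, angularCoeff_eq_zero hM this, mul_zero, ite_self]
  have hFint : Integrable F := by
    rw [← integrableOn_iff_integrable_of_support_subset hFsupp]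
    refine Measure.integrableOn_of_bounded (M := M ^ n * (C * T)) ?_
      hFm.aestronglyMeasurable ?_
    · exact (isCompact_Icc.prod isCompact_Icc).measure_lt_top.ne
    · refine (ae_restrict_iff' (measurableSet_Icc.prod measurableSet_Icc)).2
        (Eventually.of_forall fun p hp => ?_)
      by_cases h0 : 0 < p.1
      · simp only [hF, if_pos h0, norm_mul, norm_exp_ofReal_mul_ofReal_mul_I, one_mul,
          Complex.norm_real, Real.norm_eq_abs, abs_pow, abs_of_pos h0]
        have hM0 : 0 ≤ M := h0.le.trans hp.1.2
        gcongr
        · exact hp.1.2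
        · exact norm_angularCoeff_le hT hC _
      · have hM0 : 0 ≤ M := by linarith [hp.1.1, hp.1.2]
        simp only [hF, if_neg h0, norm_zero]
        positivity
  have hzero : ∫ p, F p = 0 := by
    rw [Measure.volume_eq_prod, integral_prod _ hFint]
    refine integral_eq_zero_of_ae ?_
    filter_upwards [hX] with d hd
    rw [Pi.zero_apply]
    by_cases h0 : 0 < d
    swap
    · simp [hF, h0]
    simp only [hF, if_pos h0]
    rw [integral_const_mul]
    simp_rw [hA, ← integral_exp_mul_comp_add hper hl, intervalIntegral.integral_of_le hT.le]
    -- After the swap the inner integral runs along a single line, where `hX` applies.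
    rw [integral_integral_swap]
    · have : ∫ y in Ioc 0 T, ∫ x : ℝ, Complex.exp (l * y * Complex.I) *
          H √(d ^ 2 + x ^ 2) (y + Real.arctan (x / d)) = 0 := by
        refine integral_eq_zero_of_ae (ae_restrict_of_ae ?_)
        filter_upwards [hd h0] with y hy
        rw [integral_const_mul, integral_complex_ofReal, hy]
        simp
      rw [this, mul_zero]
    · have hm : Measurable fun p : ℝ × ℝ => Complex.exp (l * p.2 * Complex.I) *
          H √(d ^ 2 + p.1 ^ 2) (p.2 + Real.arctan (p.1 / d)) := by
        have h1 : Measurable fun p : ℝ × ℝ =>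
            H √(d ^ 2 + p.1 ^ 2) (p.2 + Real.arctan (p.1 / d)) :=
          hH.comp (f := fun p : ℝ × ℝ => (√(d ^ 2 + p.1 ^ 2), p.2 + Real.arctan (p.1 / d)))
            (by fun_prop)
        have h2 : Measurable fun p : ℝ × ℝ =>
            ((H √(d ^ 2 + p.1 ^ 2) (p.2 + Real.arctan (p.1 / d)) : ℝ) : ℂ) :=
          Complex.measurable_ofReal.comp h1
        exact Measurable.mul (by fun_prop) h2
      have hprod : (volume : Measure ℝ).prod (volume.restrict (Ioc 0 T)) =
          (volume : Measure (ℝ × ℝ)).restrict (univ ×ˢ Ioc 0 T) := by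
        rw [Measure.volume_eq_prod, ← Measure.prod_restrict, Measure.restrict_univ]
      rw [hprod]
      refine IntegrableOn.of_forall_sdiff_eq_zero (s := Icc (-M) M ×ˢ Ioc 0 T) ?_
        (MeasurableSet.univ.prod measurableSet_Ioc) ?_
      · refine Measure.integrableOn_of_bounded (M := C) ?_ hm.aestronglyMeasurable ?_
        · rw [Measure.volume_eq_prod, Measure.prod_prod]
          exact (ENNReal.mul_lt_top (by simp) (by simp)).ne
        · refine Eventually.of_forall fun p => ?_
          simp only [Function.uncurry, norm_mul, norm_exp_ofReal_mul_ofReal_mul_I, one_mul,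
            Complex.norm_real]
          exact hC _ _
      · rintro ⟨x, y⟩ ⟨⟨-, hy⟩, hxy⟩
        have : M < √(d ^ 2 + x ^ 2) := by
          by_contra! hle
          exact hxy ⟨abs_le.1 ((hle2 d x).trans hle), hy⟩
        simp [Function.uncurry, hM _ _ this]
  rw [← integral_comp_polarCoord_symm] at hzero
  rw [integral_Icc_eq_integral_Ioo]
  have hsplit : ∫ φ in Ioo (-(Real.pi / 2)) (Real.pi / 2),
      (Real.cos φ ^ n) • Complex.exp ((-l : ℝ) * φ * Complex.I) =
      ∫ φ in Ioo (-Real.pi) Real.pi, (Ioo (-(Real.pi / 2)) (Real.pi / 2)).indicator (fun φ : ℝ =>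
        (Real.cos φ ^ n) • Complex.exp ((-l : ℝ) * φ * Complex.I)) φ := by
    rw [setIntegral_indicator measurableSet_Ioo, inter_eq_self_of_subset_right]
    exact Ioo_subset_Ioo (by linarith) (by linarith)
  rw [hsplit, ← setIntegral_prod_mul, ← Measure.volume_eq_prod, ← hzero]
  refine setIntegral_congr_fun (measurableSet_Ioi.prod measurableSet_Ioo) ?_
  rintro ⟨r, φ⟩ ⟨hr, hφ⟩
  simp only [mem_Ioi, mem_Ioo] at hr hφ
  simp only [polarCoord_symm_apply, hF]
  by_cases hφ2 : φ ∈ Ioo (-(Real.pi / 2)) (Real.pi / 2)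
  · have hc : 0 < Real.cos φ := Real.cos_pos_of_mem_Ioo hφ2
    have hs : √((r * Real.cos φ) ^ 2 + (r * Real.sin φ) ^ 2) = r := by
      rw [mul_pow, mul_pow, ← mul_add, Real.cos_sq_add_sin_sq, mul_one, Real.sqrt_sq hr.le]
    have ht : Real.arctan (r * Real.sin φ / (r * Real.cos φ)) = φ := by
      rw [mul_div_mul_left _ _ hr.ne', ← Real.tan_eq_sin_div_cos,
        Real.arctan_tan hφ2.1 hφ2.2]
    rw [indicator_of_mem hφ2, if_pos (mul_pos hr hc), hs, ht]
    simp only [Complex.real_smul]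
    push_cast
    rw [show (l : ℂ) * -(φ : ℂ) = -(l : ℂ) * φ by ring]
    ring
  · have hc : Real.cos φ ≤ 0 := by
      by_contra! hpos
      refine hφ2 ?_
      rw [mem_Ioo, ← abs_lt]
      by_contra! hge
      have := Real.cos_nonpos_of_pi_div_two_le_of_le hge
        (by linarith [abs_lt.2 hφ])
      rw [Real.cos_abs] at this
      linarith
    rw [indicator_of_notMem hφ2, if_neg (by nlinarith)]
    simp

/-- Injectivity of the X-ray transform on a cone of arbitrary total angle `T`, for bounded functions
of bounded support: the lines at distance `d` from the vertex are
`s ↦ (√(d² + s²), x + arctan (s / d))` in polar coordinates. -/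
theorem ae_eq_zero_of_xray_cone_eq_zero (hT : 0 < T) (hH : Measurable (Function.uncurry H))
    (hC : ∀ r x, |H r x| ≤ C) (hM : ∀ r x, M < r → H r x = 0)
    (hper : ∀ r, Function.Periodic (H r) T)
    (hX : ∀ᵐ d : ℝ, 0 < d → ∀ᵐ x : ℝ,
      ∫ s : ℝ, H √(d ^ 2 + s ^ 2) (x + Real.arctan (s / d)) = 0) :
    ∀ᵐ r : ℝ, 0 < r → ∀ᵐ x : ℝ, H r x = 0 := by
  have hcoef : ∀ k : ℤ, ∀ᵐ r : ℝ, 0 < r → angularCoeff H T (2 * Real.pi * k / T) r = 0 := by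
    intro k
    set l := 2 * Real.pi * k / T with hl
    have hl1 : Complex.exp (l * T * Complex.I) = 1 := by
      rw [Complex.exp_eq_one_iff]
      refine ⟨k, ?_⟩
      rw [← Complex.ofReal_mul, hl, div_mul_cancel₀ _ hT.ne']
      push_cast; ring
    obtain ⟨N, hN⟩ := eventually_atTop.1 (eventually_integral_cos_pow_mul_exp_ne_zero (-l))
    -- With `M + 1` as endpoint, every `r > 0` lies in the open interval or beyond `M`, where the
    -- coefficient is zero anyway.
    have hmom : ∀ n ≥ N + 1, ∫ r in Ioc 0 (M + 1), ((r ^ n : ℝ) : ℂ) * angularCoeff H T l r = 0 := by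
      intro n hn
      obtain ⟨m, rfl⟩ : ∃ m, n = m + 1 := ⟨n - 1, by lia⟩
      have h1 := (mul_eq_zero.1 (moment_angularCoeff_mul_eq_zero hT hH hC hM hper hl1 hX m)).resolve_right
        (hN m (by lia))
      rw [← h1]
      refine setIntegral_eq_of_subset_of_forall_sdiff_eq_zero measurableSet_Ioi
        (fun r hr => hr.1) ?_ |>.symm
      rintro r ⟨hr0, hr⟩
      rw [angularCoeff_eq_zero hM, mul_zero]
      by_contra! hle
      exact hr ⟨hr0, by linarith⟩
    have hz := ae_eq_zero_of_moments_eq_zero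
      (Measure.integrableOn_of_bounded (M := C * T) (by simp)
        (measurable_angularCoeff (l := l) hT hH).aestronglyMeasurable
        (Eventually.of_forall fun r => norm_angularCoeff_le hT hC r)) hmom
    filter_upwards [hz] with r hr h0
    by_cases hrM : r < M + 1
    · exact hr ⟨h0, hrM⟩
    · exact angularCoeff_eq_zero hM (by linarith)
  filter_upwards [ae_all_iff.2 hcoef] with r hr h0
  have hm : Measurable fun x => ((H r x : ℝ) : ℂ) :=
    Complex.measurable_ofReal.comp (hH.comp measurable_prodMk_left)
  have h1 := ae_eq_zero_of_fourier_integrals_eq_zero hT hm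
    (fun x => by rw [Complex.norm_real]; exact hC r x) (fun k => hr k h0)
  -- The Fourier argument covers one period; countably many translates of its null set cover the
  -- line.
  have h2 : ∀ᵐ x : ℝ, ∀ j : ℤ, x + j • T ∈ Ioc 0 T → ((H r (x + j • T) : ℝ) : ℂ) = 0 := by
    refine ae_all_iff.2 fun j => ?_
    exact (measurePreserving_add_right volume (j • T)).quasiMeasurePreserving.ae h1
  filter_upwards [h2] with x hx
  obtain ⟨j, hj, -⟩ := existsUnique_add_zsmul_mem_Ioc hT x 0
  rw [zero_add] at hj
  have := hx j hj
  rw [(hper r).zsmul j x] at this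
  exact_mod_cast this

end angularCoeff

/-! ### Folding the angle. -/

/-- The even `2α`-periodic function with `triangleWave α x = |x|` for `|x| ≤ α`. -/
noncomputable def triangleWave (α x : ℝ) : ℝ :=
  α / Real.pi * Real.arccos (Real.cos (Real.pi / α * x))

section triangleWave

variable {α : ℝ}

@[fun_prop]
theorem continuous_triangleWave (α : ℝ) : Continuous (triangleWave α) := by
  unfold triangleWave
  exact continuous_const.mul (Real.continuous_arccos.comp (by fun_prop))

theorem triangleWave_eq_abs (hα : 0 < α) {x : ℝ} (j : ℤ) (hx : |x - 2 * j * α| ≤ α) :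
    triangleWave α x = |x - 2 * j * α| := by
  have hpi := Real.pi_pos
  have h1 : Real.pi / α * x = Real.pi / α * (x - 2 * j * α) + j * (2 * Real.pi) := by
    field_simp; ring
  rw [triangleWave, h1, Real.cos_add_int_mul_two_pi, ← Real.cos_abs, abs_mul,
    abs_of_pos (div_pos hpi hα), Real.arccos_cos (by positivity)]
  · field_simp
  · calc Real.pi / α * |x - 2 * j * α| ≤ Real.pi / α * α := by gcongr
      _ = Real.pi := by field_simp

theorem triangleWave_periodic (hα : 0 < α) : Function.Periodic (triangleWave α) (2 * α) := by
  intro x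
  have : Real.pi / α * (x + 2 * α) = Real.pi / α * x + 2 * Real.pi := by field_simp
  rw [triangleWave, this, Real.cos_add_two_pi, triangleWave]

/-- Near every multiple of `α` the triangle wave is `c + σ |y|`, with `c = 0` or `c = α`. -/
theorem exists_triangleWave_eq (hα : 0 < α) (k : ℤ) :
    ∃ c σ : ℝ, (c = 0 ∧ σ = 1 ∨ c = α ∧ σ = -1) ∧
      ∀ x, |x - k * α| ≤ α → triangleWave α x = c + σ * |x - k * α| := by
  obtain ⟨j, rfl | rfl⟩ := Int.even_or_odd' k
  · refine ⟨0, 1, Or.inl ⟨rfl, rfl⟩, fun x hx => ?_⟩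
    push_cast at hx ⊢
    rw [triangleWave_eq_abs hα j hx, zero_add, one_mul]
  · refine ⟨α, -1, Or.inr ⟨rfl, rfl⟩, fun x hx => ?_⟩
    push_cast at hx ⊢
    rw [abs_le] at hx
    rcases le_total 0 (x - (2 * j + 1) * α) with h | h
    · rw [triangleWave_eq_abs hα (j + 1), abs_of_nonneg h, abs_of_nonpos]
      · push_cast; ring
      · push_cast; nlinarith [hx.1, hx.2]
      · push_cast; rw [abs_le]; constructor <;> nlinarith [hx.1, hx.2]
    · rw [triangleWave_eq_abs hα j, abs_of_nonpos h, abs_of_nonneg]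
      · ring
      · nlinarith [hx.1, hx.2]
      · rw [abs_le]; constructor <;> nlinarith [hx.1, hx.2]

theorem triangleWave_mem_Ioo (hα : 0 < α) {x : ℝ} (hx : ∀ k : ℤ, x ≠ k * α) :
    triangleWave α x ∈ Ioo 0 α := by
  obtain ⟨c, σ, hcσ, h⟩ := exists_triangleWave_eq hα ⌊x / α⌋
  have h1 : (⌊x / α⌋ : ℝ) * α < x :=
    lt_of_le_of_ne ((le_div_iff₀ hα).1 (Int.floor_le _)) (hx _).symm
  have h2 : x < (⌊x / α⌋ + 1) * α := (div_lt_iff₀ hα).1 (Int.lt_floor_add_one _)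
  have h3 : |x - ⌊x / α⌋ * α| = x - ⌊x / α⌋ * α := abs_of_pos (by linarith)
  rw [h x (by rw [h3]; linarith), h3]
  rcases hcσ with ⟨rfl, rfl⟩ | ⟨rfl, rfl⟩ <;> constructor <;> linarith

/-- The triangle wave at `x` is `± x` up to a multiple of the period. -/
theorem exists_eq_of_triangleWave (hα : 0 < α) (x : ℝ) :
    ∃ j : ℤ, triangleWave α x = x - 2 * j * α ∨ triangleWave α x = -(x - 2 * j * α) := by
  have h2 : (0 : ℝ) < 2 * α := by linarith
  refine ⟨round (x / (2 * α)), ?_⟩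
  have h := abs_sub_round (x / (2 * α))
  have h3 : |x - 2 * round (x / (2 * α)) * α| ≤ α := by
    have : x - 2 * round (x / (2 * α)) * α = (2 * α) * (x / (2 * α) - round (x / (2 * α))) := by
      field_simp
    rw [this, abs_mul, abs_of_pos h2]
    nlinarith
  rw [triangleWave_eq_abs hα _ h3]
  exact abs_choice _

end triangleWave

/-! ### Folded lines: affine pieces and bounces. -/

/-- The point of the closed cone with polar coordinates `r` and `triangleWave α x`. -/
noncomputable def foldPt (a : ℂ) (β α r x : ℝ) : ℂ :=
  a + r * Complex.exp ((β + triangleWave α x : ℝ) * Complex.I)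

/-- The billiard trajectory in the cone obtained by folding a straight line at distance `d` from the
vertex. -/
noncomputable def foldedLine (a : ℂ) (β α d x s : ℝ) : ℂ :=
  foldPt a β α √(d ^ 2 + s ^ 2) (x + Real.arctan (s / d))

section cone

variable {a : ℂ} {β α : ℝ}

/-- The cone is a translate of the image of a horizontal strip under the open map `exp`. -/
theorem isOpen_planarCone (a : ℂ) (β α : ℝ) : IsOpen (planarCone a β α) := by
  have h : planarCone a β α = (fun z => a + z) '' (Complex.exp '' (Complex.im ⁻¹' Ioo β (β + α))) := by
    ext z
    simp only [planarCone, mem_ofPred_eq, mem_image, mem_preimage, mem_Ioo, exists_exists_and_eq_and]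
    constructor
    · rintro ⟨r, t, hr, h1, h2, rfl⟩
      refine ⟨Real.log r + t * Complex.I, by simpa using ⟨h1, h2⟩, ?_⟩
      rw [Complex.exp_add, ← Complex.ofReal_exp, Real.exp_log hr]
    · rintro ⟨w, ⟨h1, h2⟩, rfl⟩
      refine ⟨Real.exp w.re, w.im, Real.exp_pos _, h1, h2, ?_⟩
      rw [Complex.ofReal_exp, ← Complex.exp_add, Complex.re_add_im]
  rw [h]
  exact isOpenMap_add_left a _ (Complex.isOpenMap_exp _ (isOpen_Ioo.preimage Complex.continuous_im))

theorem foldPt_mem_planarCone (hα : 0 < α) {r x : ℝ} (hr : 0 < r) (hx : ∀ k : ℤ, x ≠ k * α) :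
    foldPt a β α r x ∈ planarCone a β α := by
  have h := triangleWave_mem_Ioo hα hx
  exact ⟨r, β + triangleWave α x, hr, by linarith [h.1], by linarith [h.2], rfl⟩

theorem eq_of_polar_eq {r r' t t' : ℝ} (hr : 0 < r) (hr' : 0 < r')
    (h : (r : ℂ) * Complex.exp (t * Complex.I) = r' * Complex.exp (t' * Complex.I)) :
    r = r' ∧ ∃ n : ℤ, t = t' + n * (2 * Real.pi) := by
  have h1 : r = r' := by
    have := congrArg norm h
    rwa [norm_mul, norm_mul, Complex.norm_exp_ofReal_mul_I, Complex.norm_exp_ofReal_mul_I,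
      Complex.norm_real, Complex.norm_real, Real.norm_of_nonneg hr.le, Real.norm_of_nonneg hr'.le,
      mul_one, mul_one] at this
  refine ⟨h1, ?_⟩
  subst h1
  obtain ⟨n, hn⟩ := Complex.exp_eq_exp_iff_exists_int.1
    (mul_left_cancel₀ (by exact_mod_cast hr.ne') h)
  refine ⟨n, ?_⟩
  have := congrArg Complex.im hn
  simpa using this

/-- An endpoint of an open interval of length at most `2π` is not congruent modulo `2π` to a point
inside it. For `α = 2π` the two sides coincide and form the slit. -/
theorem side_notMem_planarCone (hα : α ≤ 2 * Real.pi) {r c : ℝ} (hr : 0 < r)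
    (hc : c = 0 ∨ c = α) :
    a + r * Complex.exp ((β + c : ℝ) * Complex.I) ∉ planarCone a β α := by
  rintro ⟨r', t, hr', h1, h2, h⟩
  obtain ⟨-, n, hn⟩ := eq_of_polar_eq hr hr' (add_left_cancel h)
  have hpi := Real.pi_pos
  have h3 : (n : ℝ) < 1 := by
    by_contra! h4
    rcases hc with rfl | rfl <;> nlinarith
  have h4 : (-1 : ℝ) < n := by
    by_contra! h4
    rcases hc with rfl | rfl <;> nlinarith
  have h5 : n = 0 := by
    have h6 : n < 1 := by exact_mod_cast h3
    have h7 : -1 < n := by exact_mod_cast h4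
    lia
  subst h5
  rcases hc with rfl | rfl <;> simp at hn <;> linarith

theorem foldPt_notMem_planarCone (hα : 0 < α) (hα' : α ≤ 2 * Real.pi) {r : ℝ} (hr : 0 < r) (k : ℤ) :
    foldPt a β α r (k * α) ∉ planarCone a β α := by
  obtain ⟨c, σ, hcσ, h⟩ := exists_triangleWave_eq hα k
  rw [foldPt, h _ (by simpa using hα.le), sub_self, abs_zero, mul_zero, add_zero]
  exact side_notMem_planarCone hα' hr (hcσ.imp And.left And.left)

theorem norm_foldPt_sub (r x : ℝ) : ‖foldPt a β α r x - a‖ = |r| := by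
  rw [foldPt, add_sub_cancel_left, norm_mul, Complex.norm_exp_ofReal_mul_I, Complex.norm_real,
    mul_one, Real.norm_eq_abs]

theorem continuous_foldPt (a : ℂ) (β α : ℝ) :
    Continuous fun p : ℝ × ℝ => foldPt a β α p.1 p.2 := by
  unfold foldPt
  fun_prop

variable {d x : ℝ}

theorem continuous_foldedLine : Continuous (foldedLine a β α d x) :=
  (continuous_foldPt a β α).comp (f := fun s => (√(d ^ 2 + s ^ 2), x + Real.arctan (s / d)))
    (by fun_prop)

theorem sqrt_add_sq_pos (hd : 0 < d) (s : ℝ) : 0 < √(d ^ 2 + s ^ 2) :=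
  Real.sqrt_pos.2 (by positivity)

theorem cos_arctan_div (hd : 0 < d) (s : ℝ) :
    √(d ^ 2 + s ^ 2) * Real.cos (Real.arctan (s / d)) = d := by
  have h : √(d ^ 2 + s ^ 2) = d * √(1 + (s / d) ^ 2) := by
    rw [← Real.sqrt_sq hd.le, ← Real.sqrt_mul (sq_nonneg _), Real.sqrt_sq hd.le]
    congr 1; field_simp
  have h0 : 0 < √(1 + (s / d) ^ 2) := Real.sqrt_pos.2 (by positivity)
  rw [Real.cos_arctan, h]
  field_simp

theorem sin_arctan_div (hd : 0 < d) (s : ℝ) :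
    √(d ^ 2 + s ^ 2) * Real.sin (Real.arctan (s / d)) = s := by
  have h := cos_arctan_div hd s
  have h1 := Real.tan_mul_cos (Real.cos_arctan_pos (s / d)).ne'
  rw [Real.tan_arctan] at h1
  rw [← h1, mul_left_comm, h, div_mul_cancel₀ _ hd.ne']

/-- This is why the polar curve is a straight line: it is `d + i s`, or its mirror image for `σ =
-1`. -/
theorem sqrt_mul_exp_arctan (hd : 0 < d) (s : ℝ) {σ : ℝ} (hσ : σ = 1 ∨ σ = -1) :
    (√(d ^ 2 + s ^ 2) : ℂ) * Complex.exp ((σ * Real.arctan (s / d) : ℝ) * Complex.I) =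
      d + (σ * s : ℝ) * Complex.I := by
  have h1 := cos_arctan_div hd s
  have h2 := sin_arctan_div hd s
  have h3 : (√(d ^ 2 + s ^ 2) : ℂ) * Real.cos (Real.arctan (s / d)) = d := by exact_mod_cast h1
  have h4 : (√(d ^ 2 + s ^ 2) : ℂ) * Real.sin (Real.arctan (s / d)) = s := by exact_mod_cast h2
  rw [Complex.exp_mul_I, ← Complex.ofReal_cos, ← Complex.ofReal_sin]
  rcases hσ with rfl | rfl
  · rw [one_mul, one_mul]
    linear_combination h3 + Complex.I * h4
  · rw [neg_one_mul, neg_one_mul, Real.cos_neg, Real.sin_neg, Complex.ofReal_neg, Complex.ofReal_neg]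
    linear_combination h3 - Complex.I * h4

theorem strictMono_lineAngle (hd : 0 < d) : StrictMono fun s => x + Real.arctan (s / d) :=
  fun s t hst => by
    have : Real.arctan (s / d) < Real.arctan (t / d) :=
      Real.arctan_strictMono (div_lt_div_of_pos_right hst hd)
    simpa using this

theorem continuous_lineAngle : Continuous fun s => x + Real.arctan (s / d) := by fun_prop

/-- The folded line is affine where it does not cross the sides of the cone. -/
theorem foldedLine_eq_of_mem (hd : 0 < d) {k c σ τ s : ℝ} (hσ : σ = 1 ∨ σ = -1)
    (hτ : τ = 1 ∨ τ = -1)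
    (h : triangleWave α (x + Real.arctan (s / d)) = c + σ * |x + Real.arctan (s / d) - k|)
    (hk : |x + Real.arctan (s / d) - k| = τ * (x + Real.arctan (s / d) - k)) :
    foldedLine a β α d x s = a + Complex.exp ((β + c + σ * τ * (x - k) : ℝ) * Complex.I) *
      (d + (σ * τ * s : ℝ) * Complex.I) := by
  have hστ : σ * τ = 1 ∨ σ * τ = -1 := by
    rcases hσ with rfl | rfl <;> rcases hτ with rfl | rfl <;> simp
  rw [foldedLine, foldPt, h, hk, ← sqrt_mul_exp_arctan hd s hστ, mul_left_comm (Complex.exp _),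
    ← Complex.exp_add]
  congr 3
  push_cast; ring

/-- The set of times at which the folded line meets the sides of the cone. -/
def crossingTimes (α d x : ℝ) : Set ℝ := {s | ∃ k : ℤ, x + Real.arctan (s / d) = k * α}

/-- The angle is strictly increasing and stays within `π/2` of `x`, so it passes finitely many
multiples of `α`. -/
theorem finite_crossingTimes (hα : 0 < α) (hd : 0 < d) : (crossingTimes α d x).Finite := by
  have hfin : ((fun k : ℤ => (k : ℝ) * α) '' Icc ⌈(x - Real.pi / 2) / α⌉ ⌊(x + Real.pi / 2) / α⌋).Finite :=
    (finite_Icc _ _).image _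
  refine (hfin.preimage (f := fun s => x + Real.arctan (s / d))
    (strictMono_lineAngle hd).injective.injOn).subset ?_
  rintro s ⟨k, hk⟩
  refine ⟨k, ⟨?_, ?_⟩, hk.symm⟩
  · rw [Int.ceil_le, div_le_iff₀ hα, ← hk]
    linarith [Real.neg_pi_div_two_lt_arctan (s / d)]
  · rw [Int.le_floor, le_div_iff₀ hα, ← hk]
    linarith [Real.arctan_lt_pi_div_two (s / d)]

theorem exists_foldedLine_eq_affine (hα : 0 < α) (hd : 0 < d) {s t : ℝ} (hst : s < t)
    (h : Disjoint (Ioo s t) (crossingTimes α d x)) :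
    ∃ v : ℂ, ‖v‖ = 1 ∧ ∀ u ∈ Icc s t,
      foldedLine a β α d x u = foldedLine a β α d x s + (u - s) • v := by
  set θ : ℝ → ℝ := fun s => x + Real.arctan (s / d) with hθ
  have hθm : StrictMono θ := strictMono_lineAngle hd
  have hθc : Continuous θ := continuous_lineAngle
  obtain ⟨m, hsm, hmt⟩ := exists_between hst
  -- The index is read off at an interior time, since `s` and `t` may themselves be crossing times.
  set k := ⌊θ m / α⌋ with hk
  have h1 : (k : ℝ) * α ≤ θ m := (le_div_iff₀ hα).1 (Int.floor_le _)
  have h2 : θ m < (k + 1) * α := (div_lt_iff₀ hα).1 (Int.lt_floor_add_one _)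
  have hs : (k : ℝ) * α ≤ θ s := by
    by_contra! hlt
    obtain ⟨u, hu, hu'⟩ := intermediate_value_Ioc hsm.le hθc.continuousOn ⟨hlt, h1⟩
    exact disjoint_left.1 h ⟨hu.1, hu.2.trans_lt hmt⟩ ⟨k, hu'⟩
  have ht : θ t ≤ (k + 1) * α := by
    by_contra! hlt
    obtain ⟨u, hu, hu'⟩ := intermediate_value_Ico hmt.le hθc.continuousOn ⟨h2.le, hlt⟩
    exact disjoint_left.1 h ⟨hsm.trans_le hu.1, hu.2⟩ ⟨k + 1, by push_cast; exact hu'⟩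
  obtain ⟨c, σ, hcσ, htri⟩ := exists_triangleWave_eq hα k
  have hσ : σ = 1 ∨ σ = -1 := hcσ.imp And.right And.right
  have key : ∀ u ∈ Icc s t, foldedLine a β α d x u =
      a + Complex.exp ((β + c + σ * 1 * (x - k * α) : ℝ) * Complex.I) *
        (d + (σ * 1 * u : ℝ) * Complex.I) := by
    intro u hu
    have h3 : (k : ℝ) * α ≤ θ u := hs.trans (hθm.monotone hu.1)
    have h4 : θ u ≤ (k + 1) * α := (hθm.monotone hu.2).trans ht
    have h5 : |θ u - k * α| = 1 * (θ u - k * α) := by rw [one_mul, abs_of_nonneg (by linarith)]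
    exact foldedLine_eq_of_mem hd hσ (Or.inl rfl) (htri _ (by rw [h5]; linarith)) h5
  refine ⟨Complex.exp ((β + c + σ * 1 * (x - k * α) : ℝ) * Complex.I) * (σ * Complex.I), ?_, ?_⟩
  · rw [norm_mul, Complex.norm_exp_ofReal_mul_I, norm_mul, Complex.norm_I, Complex.norm_real]
    rcases hσ with rfl | rfl <;> simp
  · intro u hu
    rw [key u hu, key s (left_mem_Icc.2 hst.le), Complex.real_smul]
    push_cast; ring

/-- At a side of the cone the folded line is reflected. -/
theorem exists_foldedLine_eq_reflection (hα : 0 < α) (hd : 0 < d) {s : ℝ}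
    (hs : s ∈ crossingTimes α d x) :
    ∃ (c y z : ℝ) (m : ℂ), (c = 0 ∨ c = α) ∧ 0 < z ∧
      (m = Complex.exp ((β + c : ℝ) * Complex.I) * Complex.I ∨
        m = -(Complex.exp ((β + c : ℝ) * Complex.I) * Complex.I)) ∧
      foldedLine a β α d x s = a + √(d ^ 2 + s ^ 2) * Complex.exp ((β + c : ℝ) * Complex.I) ∧
      ∀ᶠ t in 𝓝 s, foldedLine a β α d x t = foldedLine a β α d x s +
        ((t - s) * y) • Complex.exp ((β + c : ℝ) * Complex.I) + (|t - s| * z) • m := by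
  obtain ⟨k, hk⟩ := hs
  obtain ⟨c, σ, hcσ, htri⟩ := exists_triangleWave_eq hα k
  have hσ : σ = 1 ∨ σ = -1 := hcσ.imp And.right And.right
  set e := Complex.exp ((β + c : ℝ) * Complex.I) with he
  set φ := Real.arctan (s / d) with hφ
  have hval : foldedLine a β α d x s = a + √(d ^ 2 + s ^ 2) * e := by
    rw [foldedLine, foldPt, hk, htri _ (by simpa using hα.le), sub_self, abs_zero, mul_zero,
      add_zero]
  -- `sin φ` and `cos φ` are the tangential and normal speeds; `cos φ > 0` makes the hit
  -- transversal.
  refine ⟨c, Real.sin φ, Real.cos φ, σ * (e * Complex.I), hcσ.imp And.left And.left,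
    Real.cos_arctan_pos _, ?_, hval, ?_⟩
  · rcases hσ with rfl | rfl
    · left; simp [he]
    · right; simp [he]
  · have hnear : ∀ᶠ t in 𝓝 s, |x + Real.arctan (t / d) - k * α| < α := by
      have hc : Continuous fun t => |x + Real.arctan (t / d) - k * α| := by fun_prop
      refine hc.continuousAt.eventually_lt continuousAt_const ?_
      simpa [← hφ, hk] using hα
    filter_upwards [hnear] with t ht
    have hmono := (strictMono_lineAngle (x := x) hd).monotone
    -- `τ` is the sign of `t - s`, hence of the angle measured from `k * α`; one computation serves
    -- both sides of the bounce.
    have key : ∀ τ : ℝ, τ = 1 ∨ τ = -1 → |x + Real.arctan (t / d) - k * α| =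
        τ * (x + Real.arctan (t / d) - k * α) → |t - s| = τ * (t - s) →
        foldedLine a β α d x t = foldedLine a β α d x s +
          ((t - s) * Real.sin φ) • e + (|t - s| * Real.cos φ) • (σ * (e * Complex.I)) := by
      intro τ hτ h1 h2
      have hστ : σ * τ = 1 ∨ σ * τ = -1 := by
        rcases hσ with rfl | rfl <;> rcases hτ with rfl | rfl <;> simp
      have h4 : |x + φ - k * α| = τ * (x + φ - k * α) := by rw [hk]; simp
      rw [foldedLine_eq_of_mem hd hσ hτ (htri _ ht.le) h1,
        foldedLine_eq_of_mem hd hσ hτ (htri _ (by rw [← hφ, hk]; simpa using hα.le)) h4, h2]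
      have h5 : x - k * α = -φ := by linarith
      have h6 : Complex.exp ((β + c + σ * τ * (x - k * α) : ℝ) * Complex.I) =
          e * (Real.cos φ - (σ * τ * Real.sin φ : ℝ) * Complex.I) := by
        rw [h5, he, show ((β + c + σ * τ * -φ : ℝ) : ℂ) * Complex.I =
          (β + c : ℝ) * Complex.I + (-(σ * τ * φ) : ℝ) * Complex.I by push_cast; ring,
          Complex.exp_add]
        congr 1
        rw [Complex.exp_mul_I, ← Complex.ofReal_cos, ← Complex.ofReal_sin, Real.cos_neg, Real.sin_neg]
        rcases hστ with h | h <;> simp [h, sub_eq_add_neg]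
      have h7 : ((σ : ℂ) * τ) * (σ * τ) = 1 := by
        have : (σ * τ) * (σ * τ) = 1 := by rcases hστ with h | h <;> rw [h] <;> norm_num
        exact_mod_cast this
      rw [h6]
      simp only [Complex.real_smul]
      push_cast
      linear_combination (-(t - s : ℂ) * Complex.sin φ * e * (Complex.I * Complex.I)) * h7 + (-(t - s : ℂ) * Complex.sin φ * e) * Complex.I_mul_I
    rcases le_total s t with hst | hst
    · have h1 := hmono hst
      simp only [← hφ, hk] at h1
      exact key 1 (Or.inl rfl) (by rw [one_mul, abs_of_nonneg (by linarith)])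
        (by rw [one_mul, abs_of_nonneg (by linarith)])
    · have h1 := hmono hst
      simp only [← hφ, hk] at h1
      exact key (-1) (Or.inr rfl) (by rw [neg_one_mul, abs_of_nonpos (by linarith)])
        (by rw [neg_one_mul, abs_of_nonpos (by linarith)])

end cone

/-! ### Outer normals and the reflection law. -/

section reflection

variable {Ω R : Set ℂ} {p ν e m : ℂ} {γ : ℝ → ℂ} {s y z : ℝ}

/-- If `ν` were not orthogonal to `e`, one of the directions `± e` would point into the sector
around `-ν`, which lies in `Ω` near `p`. -/
theorem inner_eq_zero_of_tangent (hν : IsOuterUnitNormal Ω p ν)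
    (hside : ∀ᶠ t : ℝ in 𝓝 0, p + t • e ∉ Ω) (he : ‖e‖ = 1) : inner ℝ ν e = 0 := by
  by_contra hne
  have hpos : 0 < |inner ℝ ν e| / 2 := by positivity
  have htend : Tendsto (fun t : ℝ => p + t • e) (𝓝 0) (𝓝 p) := by
    have : Continuous fun t : ℝ => p + t • e := by fun_prop
    simpa using this.tendsto 0
  have h : ∀ᶠ t : ℝ in 𝓝 0, ¬ t * inner ℝ ν e < -(|inner ℝ ν e| / 2 * |t|) := by
    filter_upwards [htend.eventually (hν.2.2 _ hpos), hside] with t h1 h2 h3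
    refine h2 (h1.1 ?_)
    rwa [add_sub_cancel_left, real_inner_smul_right, norm_smul, he, mul_one, Real.norm_eq_abs]
  rcases lt_or_gt_of_ne hne with hi | hi
  · obtain ⟨t, ht, ht0⟩ := ((h.filter_mono nhdsWithin_le_nhds).and
      (self_mem_nhdsWithin : Ioi (0 : ℝ) ∈ 𝓝[>] 0)).exists
    change 0 < t at ht0
    rw [abs_of_neg hi, abs_of_pos ht0] at ht
    exact ht (by nlinarith)
  · obtain ⟨t, ht, ht0⟩ := ((h.filter_mono nhdsWithin_le_nhds).and
      (self_mem_nhdsWithin : Iio (0 : ℝ) ∈ 𝓝[<] 0)).exists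
    change t < 0 at ht0
    rw [abs_of_pos hi, abs_of_neg ht0] at ht
    exact ht (by nlinarith)

theorem eq_mul_I_or_of_inner_eq_zero (hν : ‖ν‖ = 1) (he : ‖e‖ = 1) (h : inner ℝ ν e = 0) :
    ν = e * Complex.I ∨ ν = -(e * Complex.I) := by
  have hn : ν.re * ν.re + ν.im * ν.im = 1 := by
    rw [← Complex.normSq_apply, Complex.normSq_eq_norm_sq, hν, one_pow]
  have hee : e.re * e.re + e.im * e.im = 1 := by
    rw [← Complex.normSq_apply, Complex.normSq_eq_norm_sq, he, one_pow]
  have h0 : ν.re * e.re + ν.im * e.im = 0 := by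
    rw [Complex.inner, Complex.mul_re, Complex.conj_re, Complex.conj_im] at h
    linarith
  set t := ν.im * e.re - ν.re * e.im with ht
  have h1 : ν.re = -(t * e.im) := by
    rw [ht]; linear_combination (-ν.re) * hee + e.re * h0
  have h2 : ν.im = t * e.re := by
    rw [ht]; linear_combination (-ν.im) * hee + e.im * h0
  have htt : (t - 1) * (t + 1) = 0 := by
    rw [h1, h2] at hn
    linear_combination hn - t * t * hee
  rcases mul_eq_zero.1 htt with h3 | h3
  · left
    have : t = 1 := by linarith
    rw [this] at h1 h2
    apply Complex.ext <;> simp [h1, h2]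
  · right
    have : t = -1 := by linarith
    rw [this] at h1 h2
    apply Complex.ext <;> simp [h1, h2]

theorem inner_eq_zero_of_eq_mul_I (hm : m = e * Complex.I ∨ m = -(e * Complex.I)) :
    inner ℝ m e = 0 := by
  rcases hm with rfl | rfl <;> simp [Complex.inner, Complex.mul_re] <;> ring

theorem norm_eq_one_of_eq_mul_I (he : ‖e‖ = 1) (hm : m = e * Complex.I ∨ m = -(e * Complex.I)) :
    ‖m‖ = 1 := by
  rcases hm with rfl | rfl <;> simp [he]

theorem norm_reflected_path_le (he : ‖e‖ = 1) (hm : ‖m‖ = 1) (hz : 0 < z) (t : ℝ) :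
    ‖(t * y) • e + (|t| * z) • m‖ ≤ (|y| + z) * |t| := by
  refine (norm_add_le _ _).trans_eq ?_
  rw [norm_smul, norm_smul, he, hm, Real.norm_eq_abs, Real.norm_eq_abs, abs_mul, abs_mul, abs_abs,
    abs_of_pos hz]
  ring

/-- If a path that bounces off a line at `p` meets `Ω` arbitrarily close to `p`, the outer normal
of `Ω` at `p` points away from the path. -/
theorem normal_eq_neg (hν : IsOuterUnitNormal Ω p ν) (hside : ∀ᶠ t : ℝ in 𝓝 0, p + t • e ∉ Ω)
    (he : ‖e‖ = 1) (hm : m = e * Complex.I ∨ m = -(e * Complex.I)) (hz : 0 < z)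
    (hγc : ContinuousAt γ s) (hγs : γ s = p)
    (hγ : ∀ᶠ t in 𝓝 s, γ t = p + ((t - s) * y) • e + (|t - s| * z) • m)
    (hfreq : ∃ᶠ t in 𝓝[≠] s, γ t ∈ Ω) : ν = -m := by
  have hm1 := norm_eq_one_of_eq_mul_I he hm
  have hme := inner_eq_zero_of_eq_mul_I hm
  have hνm : ν = m ∨ ν = -m := by
    rcases eq_mul_I_or_of_inner_eq_zero hν.2.1 he (inner_eq_zero_of_tangent hν hside he) with h | h <;>
      rcases hm with rfl | rfl <;> simp [h]
  refine hνm.resolve_left fun h => ?_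
  subst h
  have hK : 0 < |y| + z := by positivity
  -- The path rises `|t - s| * z` above the line at distance at most `(|y| + z) * |t - s|` from `p`;
  -- half of this ratio puts it strictly inside the sector around `m`.
  have hε : 0 < z / (2 * (|y| + z)) := by positivity
  refine hfreq ?_
  have h1 : ∀ᶠ t in 𝓝[≠] s, t ≠ s := self_mem_nhdsWithin
  rw [ContinuousAt, hγs] at hγc
  filter_upwards [(hγc.eventually (hν.2.2 _ hε)).filter_mono nhdsWithin_le_nhds,
    hγ.filter_mono nhdsWithin_le_nhds, h1] with t ht hγt hts
  refine ht.2 ?_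
  have hpos : 0 < |t - s| := abs_pos.2 (sub_ne_zero.2 hts)
  rw [hγt, add_assoc, add_sub_cancel_left, inner_add_right, real_inner_smul_right,
    real_inner_smul_right, hme, real_inner_self_eq_norm_sq, hm1]
  calc _ ≤ z / (2 * (|y| + z)) * ((|y| + z) * |t - s|) := by
        gcongr; exact norm_reflected_path_le he hm1 hz _
    _ = z / 2 * |t - s| := by field_simp
    _ < _ := by nlinarith

/-- Both branches of the bounce run in a sector around the inner normal `m`, so the path is in `Ω`
just before and just after. -/
theorem eventually_mem_of_normal_eq_neg (hν : IsOuterUnitNormal Ω p (-m))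
    (he : ‖e‖ = 1) (hm : m = e * Complex.I ∨ m = -(e * Complex.I)) (hz : 0 < z)
    (hγc : ContinuousAt γ s) (hγs : γ s = p)
    (hγ : ∀ᶠ t in 𝓝 s, γ t = p + ((t - s) * y) • e + (|t - s| * z) • m) :
    ∀ᶠ t in 𝓝[≠] s, γ t ∈ Ω := by
  have hm1 := norm_eq_one_of_eq_mul_I he hm
  have hme := inner_eq_zero_of_eq_mul_I hm
  have hK : 0 < |y| + z := by positivity
  have hε : 0 < z / (2 * (|y| + z)) := by positivity
  have h1 : ∀ᶠ t in 𝓝[≠] s, t ≠ s := self_mem_nhdsWithin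
  rw [ContinuousAt, hγs] at hγc
  filter_upwards [(hγc.eventually (hν.2.2 _ hε)).filter_mono nhdsWithin_le_nhds,
    hγ.filter_mono nhdsWithin_le_nhds, h1] with t ht hγt hts
  refine ht.1 ?_
  have hpos : 0 < |t - s| := abs_pos.2 (sub_ne_zero.2 hts)
  rw [hγt, add_assoc, add_sub_cancel_left, inner_neg_left, inner_add_right, real_inner_smul_right,
    real_inner_smul_right, hme, real_inner_self_eq_norm_sq, hm1, neg_lt_neg_iff]
  calc _ ≤ z / (2 * (|y| + z)) * ((|y| + z) * |t - s|) := by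
        gcongr; exact norm_reflected_path_le he hm1 hz _
    _ = z / 2 * |t - s| := by field_simp
    _ < _ := by nlinarith

/-- The one-sided derivatives of a curve at a reflection obey the reflection law. -/
def ReflectsAt (Ω : Set ℂ) (γ : ℝ → ℂ) (s : ℝ) : Prop :=
  ∃ vi vo ν : ℂ, HasDerivWithinAt γ vi (Iic s) s ∧ HasDerivWithinAt γ vo (Ici s) s ∧
    IsOuterUnitNormal Ω (γ s) ν ∧ vo = vi - (2 * inner ℝ ν vi) • ν

theorem reflectsAt_of_normal_eq_neg (hν : IsOuterUnitNormal Ω p (-m))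
    (he : ‖e‖ = 1) (hm : m = e * Complex.I ∨ m = -(e * Complex.I)) (hγs : γ s = p)
    (hγ : ∀ᶠ t in 𝓝 s, γ t = p + ((t - s) * y) • e + (|t - s| * z) • m) :
    ReflectsAt Ω γ s := by
  have hm1 := norm_eq_one_of_eq_mul_I he hm
  have hme := inner_eq_zero_of_eq_mul_I hm
  have hder : ∀ τ : ℝ, HasDerivAt (fun t : ℝ => p + ((t - s) * y) • e + (τ * (t - s) * z) • m)
      (y • e + (τ * z) • m) s := by
    intro τ
    have h1 : HasDerivAt (fun t : ℝ => (t - s) * y) y s := by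
      simpa using ((hasDerivAt_id s).sub_const s).mul_const y
    have h2 : HasDerivAt (fun t : ℝ => τ * (t - s) * z) (τ * z) s := by
      simpa using (((hasDerivAt_id s).sub_const s).const_mul τ).mul_const z
    exact ((h1.smul_const e).const_add p).add (h2.smul_const m)
  -- The tangential velocity is kept, and the normal one changes sign with `|t - s|`.
  refine ⟨y • e + (-1 * z) • m, y • e + (1 * z) • m, -m, ?_, ?_, hγs ▸ hν, ?_⟩
  · refine (hder (-1)).hasDerivWithinAt.congr_of_eventuallyEq ?_ (by simp [hγs])
    filter_upwards [hγ.filter_mono nhdsWithin_le_nhds, self_mem_nhdsWithin] with t ht hts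
    rw [ht, abs_of_nonpos (sub_nonpos.2 hts), neg_one_mul]
  · refine (hder 1).hasDerivWithinAt.congr_of_eventuallyEq ?_ (by simp [hγs])
    filter_upwards [hγ.filter_mono nhdsWithin_le_nhds, self_mem_nhdsWithin] with t ht hts
    rw [ht, abs_of_nonneg (sub_nonneg.2 hts), one_mul]
  · have : inner ℝ (-m) (y • e + (-1 * z) • m) = z := by
      rw [inner_neg_left, inner_add_right, real_inner_smul_right,
        real_inner_smul_right, hme, real_inner_self_eq_norm_sq, hm1]
      ring
    rw [this]
    module

/-- A curve that is piecewise linear, runs in `Ω` except for reflections, and ends on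
`frontier Ω \ R` is a broken ray. -/
theorem isBrokenRay_of_reflectsAt (hΩ : IsOpen Ω) {s₀ s₁ : ℝ} (h01 : s₀ < s₁) {B : Set ℝ}
    (hB : B.Finite)
    (hlin : ∀ a b : ℝ, a < b → Disjoint (Ioo a b) B →
      ∃ v : ℂ, ‖v‖ = 1 ∧ ∀ t ∈ Icc a b, γ t = γ a + (t - a) • v)
    (h0 : γ s₀ ∈ frontier Ω \ R) (h1 : γ s₁ ∈ frontier Ω \ R)
    (hin : ∀ s ∈ Ioo s₀ s₁, γ s ∈ Ω ∧ s ∉ B ∨ γ s ∈ frontier Ω ∧ ReflectsAt Ω γ s) :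
    IsBrokenRay Ω R (s₁ - s₀) fun t => γ (s₀ + t) where
  length_pos := sub_pos.2 h01
  mem_closure t ht := by
    rcases ht.1.eq_or_lt with rfl | ht0
    · simpa using frontier_subset_closure h0.1
    rcases ht.2.eq_or_lt with rfl | ht1
    · simpa using frontier_subset_closure h1.1
    rcases hin (s₀ + t) ⟨by linarith, by linarith⟩ with h | h
    · exact subset_closure h.1
    · exact frontier_subset_closure h.1
  start_mem := by simpa using h0
  end_mem := by simpa using h1
  piecewise_linear := by
    refine ⟨(fun t => s₀ + t) ⁻¹' B, hB.preimage (add_right_injective s₀).injOn, ?_⟩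
    intro a b _ hab _ hd
    obtain ⟨v, hv, h⟩ := hlin (s₀ + a) (s₀ + b) (by linarith) (by
      rw [disjoint_left] at hd ⊢
      intro u hu huB
      exact hd (a := u - s₀) ⟨by linarith [hu.1], by linarith [hu.2]⟩ (by simpa using huB))
    refine ⟨v, hv, fun t ht => ?_⟩
    simpa using h (s₀ + t) ⟨by linarith [ht.1], by linarith [ht.2]⟩
  reflection := by
    intro s hs
    have hshift : ∀ {v : ℂ} {S S' : Set ℝ}, MapsTo (fun t => s₀ + t) S' S →
        HasDerivWithinAt γ v S (s₀ + s) → HasDerivWithinAt (fun t => γ (s₀ + t)) v S' s := by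
      intro v S S' hS hd
      have := HasDerivWithinAt.scomp (h := fun t => s₀ + t) (h' := 1) s hd
        ((hasDerivAt_id s).const_add s₀).hasDerivWithinAt hS
      simpa [Function.comp_def] using this
    have hs' : s₀ + s ∈ Ioo s₀ s₁ := ⟨by linarith [hs.1], by linarith [hs.2]⟩
    rcases hin _ hs' with ⟨hΩs, hsB⟩ | ⟨hfr, vi, vo, ν, hvi, hvo, hν, hlaw⟩
    · obtain ⟨δ, hδ, hball⟩ := Metric.isOpen_iff.1 hB.isClosed.isOpen_compl _ hsB
      rw [Real.ball_eq_Ioo] at hball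
      obtain ⟨v, -, hv⟩ := hlin (s₀ + s - δ) (s₀ + s + δ) (by linarith)
        (disjoint_left.2 fun u hu => hball hu)
      have hd : HasDerivAt γ v (s₀ + s) := by
        have h1 : HasDerivAt (fun t : ℝ => γ (s₀ + s - δ) + (t - (s₀ + s - δ)) • v) v (s₀ + s) := by
          have := (((hasDerivAt_id (s₀ + s)).sub_const (s₀ + s - δ)).smul_const v).const_add
            (γ (s₀ + s - δ))
          simpa using this
        refine h1.congr_of_eventuallyEq ?_
        filter_upwards [Icc_mem_nhds (show s₀ + s - δ < s₀ + s by linarith)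
          (show s₀ + s < s₀ + s + δ by linarith)] with t ht using hv t ht
      refine ⟨v, v, hshift (mapsTo_univ _ _) hd.hasDerivWithinAt,
        hshift (mapsTo_univ _ _) hd.hasDerivWithinAt, fun _ => rfl, fun hfr => ?_⟩
      exact absurd hΩs (hΩ.frontier_eq ▸ hfr : _ ∈ closure Ω \ Ω).2
    · refine ⟨vi, vo, hshift (fun t ht => ?_) hvi, hshift (fun t ht => ?_) hvo, fun hΩs => ?_,
        fun _ => ⟨ν, hν, hlaw⟩⟩
      · exact add_le_add_right (a := s₀) (mem_Iic.1 ht)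
      · exact add_le_add_right (a := s₀) (mem_Ici.1 ht)
      · exact absurd hΩs (hΩ.frontier_eq ▸ hfr : _ ∈ closure Ω \ Ω).2

end reflection

/-! ### Cutting folded lines into broken rays. -/

/-- If the integral of `h` vanishes over every component of a bounded open set of reals, it vanishes
over the whole set. -/
theorem setIntegral_eq_zero_of_components {G : Set ℝ} (hG : IsOpen G) (hb : Bornology.IsBounded G)
    {h : ℝ → ℝ} (hint : IntegrableOn h G)
    (hcomp : ∀ s t, s < t → s ∉ G → t ∉ G → Ioo s t ⊆ G → ∫ u in Ioo s t, h u = 0) :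
    ∫ u in G, h u = 0 := by
  set 𝒮 : Set (ℝ × ℝ) := {q | q.1 < q.2 ∧ q.1 ∉ G ∧ q.2 ∉ G ∧ Ioo q.1 q.2 ⊆ G} with h𝒮
  have hdisj : 𝒮.PairwiseDisjoint fun q => Ioo q.1 q.2 := by
    rintro ⟨s, t⟩ ⟨hst, hs, ht, hsub⟩ ⟨s', t'⟩ ⟨hst', hs', ht', hsub'⟩ hne
    refine disjoint_left.2 fun u hu hu' => hne ?_
    simp only [mem_Ioo] at hu hu' hst hst'
    have h1 : s = s' := by
      rcases lt_trichotomy s s' with h | h | h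
      · exact absurd (hsub ⟨h, hu'.1.trans hu.2⟩) hs'
      · exact h
      · exact absurd (hsub' ⟨h, hu.1.trans hu'.2⟩) hs
    have h2 : t = t' := by
      rcases lt_trichotomy t t' with h | h | h
      · exact absurd (hsub' ⟨hu'.1.trans hu.2, h⟩) ht
      · exact h
      · exact absurd (hsub ⟨hu.1.trans hu'.2, h⟩) ht'
    rw [h1, h2]
  have hcount : 𝒮.Countable := hdisj.countable_of_isOpen (fun _ _ => isOpen_Ioo)
    fun q hq => nonempty_Ioo.2 hq.1
  have hU : G = ⋃ q ∈ 𝒮, Ioo q.1 q.2 := by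
    refine Subset.antisymm (fun u hu => ?_) (iUnion₂_subset fun q hq => hq.2.2.2)
    obtain ⟨K, hK⟩ := hb.subset_closedBall 0
    have hKu : ∀ v ∈ G, |v| ≤ K := fun v hv => by simpa using hK hv
    -- The component of `u` ends at the nearest points of the complement of `G` on either side.
    set A := Iic u ∩ Gᶜ
    set D := Ici u ∩ Gᶜ
    have hA : IsClosed A := isClosed_Iic.inter hG.isClosed_compl
    have hD : IsClosed D := isClosed_Ici.inter hG.isClosed_compl
    have hAu := abs_le.1 (hKu u hu)
    have hA0 : A.Nonempty := ⟨-K - 1, by simp only [mem_Iic]; linarith, fun hv => by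
      have := abs_le.1 (hKu _ hv); linarith⟩
    have hD0 : D.Nonempty := ⟨K + 1, by simp only [mem_Ici]; linarith, fun hv => by
      have := abs_le.1 (hKu _ hv); linarith⟩
    have hAb : BddAbove A := ⟨u, fun v hv => hv.1⟩
    have hDb : BddBelow D := ⟨u, fun v hv => hv.1⟩
    have hsA := hA.csSup_mem hA0 hAb
    have htD := hD.csInf_mem hD0 hDb
    have h1 : sSup A < u := lt_of_le_of_ne hsA.1 fun h => hsA.2 (h ▸ hu)
    have h2 : u < sInf D := lt_of_le_of_ne htD.1 fun h => htD.2 (h ▸ hu)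
    refine mem_iUnion₂.2 ⟨(sSup A, sInf D), ⟨h1.trans h2, hsA.2, htD.2, fun v hv => ?_⟩, h1, h2⟩
    by_contra hvG
    rcases le_total v u with h | h
    · exact absurd (le_csSup hAb ⟨h, hvG⟩) (not_le.2 hv.1)
    · exact absurd (csInf_le hDb ⟨h, hvG⟩) (not_le.2 hv.2)
  have : Countable 𝒮 := hcount.to_subtype
  rw [biUnion_eq_iUnion] at hU
  have hsum := hasSum_integral_iUnion (s := fun q : 𝒮 => Ioo q.1.1 q.1.2)
    (fun _ => measurableSet_Ioo) (hdisj.subtype _ _) (hU ▸ hint)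
  rw [← hU] at hsum
  have h0 : ∀ q : 𝒮, ∫ u in Ioo q.1.1 q.1.2, h u = 0 := fun q =>
    hcomp _ _ q.2.1 q.2.2.1 q.2.2.2.1 q.2.2.2.2
  simp only [h0] at hsum
  exact hsum.unique hasSum_zero

section foldedLine

variable {a : ℂ} {β α d x : ℝ} {Ω R : Set ℂ}

theorem foldedLine_mem_planarCone (hα : 0 < α) (hd : 0 < d) {s : ℝ} (hs : s ∉ crossingTimes α d x) :
    foldedLine a β α d x s ∈ planarCone a β α :=
  foldPt_mem_planarCone hα (sqrt_add_sq_pos hd s) fun k hk => hs ⟨k, hk⟩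

theorem foldedLine_notMem_planarCone (hα : 0 < α) (hα' : α ≤ 2 * Real.pi) (hd : 0 < d) {s : ℝ}
    (hs : s ∈ crossingTimes α d x) : foldedLine a β α d x s ∉ planarCone a β α := by
  obtain ⟨k, hk⟩ := hs
  rw [foldedLine, hk]
  exact foldPt_notMem_planarCone hα hα' (sqrt_add_sq_pos hd s) k

/-- The folded line is reflected at a point of a side of the cone that it approaches from inside
`Ω` and at which `Ω` has an outer unit normal, and it then continues in `Ω`. -/
theorem foldedLine_reflectsAt (hα : 0 < α) (hα' : α ≤ 2 * Real.pi) (hd : 0 < d)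
    (hΩ : Ω ⊆ planarCone a β α) {s : ℝ} (hs : s ∈ crossingTimes α d x)
    (hν : ∃ ν, IsOuterUnitNormal Ω (foldedLine a β α d x s) ν)
    (hfreq : ∃ᶠ t in 𝓝[≠] s, foldedLine a β α d x t ∈ Ω) :
    ReflectsAt Ω (foldedLine a β α d x) s ∧ ∀ᶠ t in 𝓝[≠] s, foldedLine a β α d x t ∈ Ω := by
  obtain ⟨ν, hν⟩ := hν
  obtain ⟨c, y, z, m, hc, hz, hm, hval, hloc⟩ :=
    exists_foldedLine_eq_reflection (a := a) (β := β) hα hd hs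
  have he := Complex.norm_exp_ofReal_mul_I (β + c)
  have hr := sqrt_add_sq_pos hd s
  have hside : ∀ᶠ t : ℝ in 𝓝 0,
      foldedLine a β α d x s + t • Complex.exp ((β + c : ℝ) * Complex.I) ∉ Ω := by
    -- Small displacements do not reach the vertex, so the point stays on the side.
    filter_upwards [lt_mem_nhds (neg_lt_zero.2 hr)] with t ht hmem
    refine side_notMem_planarCone (a := a) (β := β) (r := √(d ^ 2 + s ^ 2) + t) hα' (by linarith) hc
      (hΩ ?_)
    convert hmem using 1
    rw [hval, Complex.real_smul]
    push_cast; ring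
  have hcont : ContinuousAt (foldedLine a β α d x) s := continuous_foldedLine.continuousAt
  have hνm : ν = -m := normal_eq_neg hν hside he hm hz hcont rfl hloc hfreq
  subst hνm
  exact ⟨reflectsAt_of_normal_eq_neg hν he hm rfl hloc,
    eventually_mem_of_normal_eq_neg hν he hm hz hcont rfl hloc⟩

variable (Ω R) in
/-- The times at which a curve is in `Ω` or at a reflecting point reached from `Ω`. -/
def travelTimes (γ : ℝ → ℂ) : Set ℝ := {s | γ s ∈ Ω ∨ γ s ∈ R ∧ ∃ᶠ t in 𝓝[≠] s, γ t ∈ Ω}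

theorem mem_crossingTimes_of_mem_frontier (hα : 0 < α) (hd : 0 < d) {s : ℝ}
    (hs : foldedLine a β α d x s ∈ frontier (planarCone a β α)) : s ∈ crossingTimes α d x := by
  by_contra h
  rw [(isOpen_planarCone a β α).frontier_eq] at hs
  exact hs.2 (foldedLine_mem_planarCone hα hd h)

/-- At a reflecting time, being in `Ω` at times arbitrarily close forces the normal to point away
from the path, and then all nearby times are in `Ω`. -/
theorem isOpen_travelTimes (hα : 0 < α) (hα' : α ≤ 2 * Real.pi) (hd : 0 < d)
    (hΩo : IsOpen Ω) (hΩ : Ω ⊆ planarCone a β α) (hR : R ⊆ frontier (planarCone a β α))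
    (hnorm : ∀ s, foldedLine a β α d x s ∈ R →
      ∃ ν, IsOuterUnitNormal Ω (foldedLine a β α d x s) ν) :
    IsOpen (travelTimes Ω R (foldedLine a β α d x)) := by
  rw [isOpen_iff_mem_nhds]
  rintro s (hs | ⟨hs, hfreq⟩)
  · filter_upwards [continuous_foldedLine.continuousAt.preimage_mem_nhds (hΩo.mem_nhds hs)] with t ht
    exact Or.inl ht
  · have h := (foldedLine_reflectsAt hα hα' hd hΩ (mem_crossingTimes_of_mem_frontier hα hd (hR hs))
      (hnorm s hs) hfreq).2
    rw [eventually_nhdsWithin_iff] at h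
    filter_upwards [h] with t ht
    by_cases hts : t = s
    · exact hts ▸ Or.inr ⟨hs, hfreq⟩
    · exact Or.inl (ht hts)

theorem foldedLine_mem_of_mem_travelTimes (hα : 0 < α) (hd : 0 < d)
    (hR : R ⊆ frontier (planarCone a β α)) {s : ℝ}
    (hs : s ∈ travelTimes Ω R (foldedLine a β α d x)) (hsB : s ∉ crossingTimes α d x) :
    foldedLine a β α d x s ∈ Ω := by
  rcases hs with hs | ⟨hs, -⟩
  · exact hs
  · exact absurd (mem_crossingTimes_of_mem_frontier hα hd (hR hs)) hsB

/-- The distance to the vertex at time `s` is `√(d² + s²) ≥ |s|`. -/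
theorem isBounded_travelTimes (hΩb : Bornology.IsBounded Ω) (hR : R ⊆ frontier Ω) :
    Bornology.IsBounded (travelTimes Ω R (foldedLine a β α d x)) := by
  obtain ⟨K, hK⟩ := hΩb.closure.subset_closedBall a
  rw [isBounded_iff_forall_norm_le]
  refine ⟨K, fun s hs => ?_⟩
  have hmem : foldedLine a β α d x s ∈ closure Ω :=
    hs.elim (fun h => subset_closure h) fun h => frontier_subset_closure (hR h.1)
  have h := hK hmem
  rw [Metric.mem_closedBall, dist_eq_norm, foldedLine, norm_foldPt_sub,
    abs_of_nonneg (Real.sqrt_nonneg _)] at h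
  refine le_trans ?_ h
  rw [Real.norm_eq_abs, ← Real.sqrt_sq_eq_abs]
  exact Real.sqrt_le_sqrt (by nlinarith [sq_nonneg d])

/-- The components of the travel times of a folded line are broken rays. -/
theorem isBrokenRay_foldedLine (hα : 0 < α) (hα' : α ≤ 2 * Real.pi) (hd : 0 < d)
    (hΩo : IsOpen Ω) (hΩ : Ω ⊆ planarCone a β α) (hRΩ : R ⊆ frontier Ω)
    (hR : R ⊆ frontier (planarCone a β α))
    (hnorm : ∀ s, foldedLine a β α d x s ∈ R →
      ∃ ν, IsOuterUnitNormal Ω (foldedLine a β α d x s) ν) {s t : ℝ} (hst : s < t)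
    (hs : s ∉ travelTimes Ω R (foldedLine a β α d x))
    (ht : t ∉ travelTimes Ω R (foldedLine a β α d x))
    (hsub : Ioo s t ⊆ travelTimes Ω R (foldedLine a β α d x)) :
    IsBrokenRay Ω R (t - s) fun u => foldedLine a β α d x (s + u) := by
  have hB := finite_crossingTimes (x := x) hα hd
  have hcl : ∀ u ∈ Icc s t, foldedLine a β α d x u ∈ closure Ω := by
    rw [← closure_Ioo hst.ne]
    refine fun u hu => closure_minimal (fun v hv => ?_)
      (isClosed_closure.preimage continuous_foldedLine) hu
    exact (hsub hv).elim (fun h => subset_closure h) fun h => frontier_subset_closure (hRΩ h.1)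
  have hend : ∀ u ∈ Icc s t, u ∉ travelTimes Ω R (foldedLine a β α d x) →
      (∃ᶠ v in 𝓝[≠] u, v ∈ Ioo s t) → foldedLine a β α d x u ∈ frontier Ω \ R := by
    intro u hu huG hfreq
    refine ⟨?_, fun huR => huG (Or.inr ⟨huR, ?_⟩)⟩
    · rw [hΩo.frontier_eq]
      exact ⟨hcl u hu, fun h => huG (Or.inl h)⟩
    -- Crossing times are isolated, so near the endpoint the times of the component are spent in `Ω`
    -- itself; an endpoint on `R` would then be a travel time.
    · have hne : ∀ᶠ v in 𝓝[≠] u, v ∉ crossingTimes α d x := by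
        have h1 : ∀ᶠ v in 𝓝 u, v ∉ crossingTimes α d x \ {u} :=
          (hB.subset sdiff_subset).isClosed.isOpen_compl.mem_nhds (by simp)
        filter_upwards [h1.filter_mono nhdsWithin_le_nhds, self_mem_nhdsWithin] with v hv hvu hvB
        exact hv ⟨hvB, hvu⟩
      refine (hfreq.and_eventually hne).mono fun v hv => ?_
      exact foldedLine_mem_of_mem_travelTimes hα hd hR (hsub hv.1) hv.2
  refine isBrokenRay_of_reflectsAt hΩo hst hB
    (fun p q hpq hdis => exists_foldedLine_eq_affine hα hd hpq hdis)
    (hend s (left_mem_Icc.2 hst.le) hs ?_) (hend t (right_mem_Icc.2 hst.le) ht ?_) ?_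
  · have : ∀ᶠ v in 𝓝[>] s, v ∈ Ioo s t := Ioo_mem_nhdsGT hst
    exact this.frequently.filter_mono (nhdsWithin_mono _ fun v hv => ne_of_gt hv)
  · have : ∀ᶠ v in 𝓝[<] t, v ∈ Ioo s t := Ioo_mem_nhdsLT hst
    exact this.frequently.filter_mono (nhdsWithin_mono _ fun v hv => ne_of_lt hv)
  · intro u hu
    rcases hsub hu with h | ⟨h, hfreq⟩
    · exact Or.inl ⟨h, fun huB => foldedLine_notMem_planarCone hα hα' hd huB (hΩ h)⟩
    · exact Or.inr ⟨hRΩ h, (foldedLine_reflectsAt hα hα' hd hΩ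
        (mem_crossingTimes_of_mem_frontier hα hd (hR h)) (hnorm u h) hfreq).1⟩

/-- If `f` and `g` have the same broken ray transform, the difference of their restrictions to a
subset `W` of full measure integrates to zero over generic folded lines. -/
theorem integral_foldedLine_eq_zero (hα : 0 < α) (hα' : α ≤ 2 * Real.pi) (hd : 0 < d)
    (hΩo : IsOpen Ω) (hΩb : Bornology.IsBounded Ω) (hΩ : Ω ⊆ planarCone a β α)
    (hRΩ : R ⊆ frontier Ω) (hR : R ⊆ frontier (planarCone a β α)) {f g : ℂ → ℝ} {W : Set ℂ} {K : ℝ}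
    (hW : W ⊆ Ω) (hfm : Measurable (W.indicator f)) (hgm : Measurable (W.indicator g))
    (hfK : ∀ z, |W.indicator f z| ≤ K) (hgK : ∀ z, |W.indicator g z| ≤ K)
    (hfg : ∀ (L : ℝ) (γ : ℝ → ℂ), IsBrokenRay Ω R L γ →
      IntegrableAlong f L γ → IntegrableAlong g L γ →
      brokenRayTransform f L γ = brokenRayTransform g L γ)
    (hnorm : ∀ s, foldedLine a β α d x s ∈ R →
      ∃ ν, IsOuterUnitNormal Ω (foldedLine a β α d x s) ν)
    (hN : ∀ᵐ s, foldedLine a β α d x s ∉ Ω \ W) :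
    ∫ s, (W.indicator f (foldedLine a β α d x s) - W.indicator g (foldedLine a β α d x s)) = 0 := by
  set γ := foldedLine a β α d x with hγ
  have hγc : Continuous γ := continuous_foldedLine
  set G := travelTimes Ω R γ with hG
  have hGb : Bornology.IsBounded G := isBounded_travelTimes hΩb hRΩ
  have hGo : IsOpen G := isOpen_travelTimes hα hα' hd hΩo hΩ hR hnorm
  have hint : ∀ {f : ℂ → ℝ}, Measurable (W.indicator f) → (∀ z, |W.indicator f z| ≤ K) →
      ∀ {S : Set ℝ}, Bornology.IsBounded S → IntegrableOn (fun s => W.indicator f (γ s)) S := by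
    intro f hfm hfK S hS
    exact Measure.integrableOn_of_bounded (M := K) hS.measure_lt_top.ne
      (hfm.comp hγc.measurable).aestronglyMeasurable (Eventually.of_forall fun s => hfK _)
  have hout : ∀ s, s ∉ G → W.indicator f (γ s) - W.indicator g (γ s) = 0 := by
    intro s hs
    have : γ s ∉ W := fun h => hs (Or.inl (hW h))
    simp [this]
  rw [← setIntegral_eq_integral_of_forall_compl_eq_zero hout]
  refine setIntegral_eq_zero_of_components hGo hGb ((hint hfm hfK hGb).sub (hint hgm hgK hGb)) ?_
  intro s t hst hs ht hsub
  have hray : IsBrokenRay Ω R (t - s) fun u => γ (s + u) :=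
    isBrokenRay_foldedLine hα hα' hd hΩo hΩ hRΩ hR hnorm hst hs ht hsub
  have hBae : ∀ᵐ u : ℝ, u ∉ crossingTimes α d x :=
    (finite_crossingTimes hα hd).countable.ae_notMem _
  have hae : ∀ f : ℂ → ℝ, ∀ᵐ u : ℝ, u ∈ uIoc s t → W.indicator f (γ u) = f (γ u) := by
    intro f
    have htne : ∀ᵐ u : ℝ, u ≠ t := (countable_singleton t).ae_notMem _
    filter_upwards [hBae, hN, htne] with u huB huN hut hu
    rw [uIoc_of_le hst.le] at hu
    have huΩ : γ u ∈ Ω :=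
      foldedLine_mem_of_mem_travelTimes hα hd hR (hsub ⟨hu.1, lt_of_le_of_ne hu.2 hut⟩) huB
    have huW : γ u ∈ W := by
      by_contra h
      exact huN ⟨huΩ, h⟩
    simp [huW]
  have hii : ∀ {f : ℂ → ℝ}, Measurable (W.indicator f) → (∀ z, |W.indicator f z| ≤ K) →
      IntervalIntegrable (fun u => W.indicator f (γ u)) volume s t := by
    intro f hfm hfK
    rw [intervalIntegrable_iff_integrableOn_Ioc_of_le hst.le]
    exact hint hfm hfK (Metric.isBounded_Ioc s t)
  have halong : ∀ {f : ℂ → ℝ}, Measurable (W.indicator f) → (∀ z, |W.indicator f z| ≤ K) →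
      IntegrableAlong f (t - s) fun u => γ (s + u) := by
    intro f hfm hfK
    have h1 : IntervalIntegrable (fun u => f (γ u)) volume s t :=
      (hii hfm hfK).congr_ae ((ae_restrict_iff' measurableSet_uIoc).2 (hae f))
    simpa [IntegrableAlong] using h1.comp_add_left s
  have htr : ∀ f : ℂ → ℝ, brokenRayTransform f (t - s) (fun u => γ (s + u)) =
      ∫ u in s..t, W.indicator f (γ u) := by
    intro f
    rw [brokenRayTransform, intervalIntegral.integral_comp_add_left (fun u => f (γ u)),
      intervalIntegral.integral_congr_ae (hae f)]
    simp
  have := hfg _ _ hray (halong hfm hfK) (halong hgm hgK)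
  rw [htr, htr] at this
  rw [← integral_Ioc_eq_integral_Ioo, ← intervalIntegral.integral_of_le hst.le,
    intervalIntegral.integral_sub (hii hfm hfK) (hii hgm hgK), this, sub_self]

end foldedLine

/-! ### Null sets and generic folded lines. -/

/-- A measurable subset of the plane is null if and only if it is null in polar coordinates. -/
theorem ae_notMem_iff_polar {A : Set ℂ} (hA : MeasurableSet A) :
    (∀ᵐ z, z ∉ A) ↔ ∀ᵐ r : ℝ, 0 < r → ∀ᵐ t : ℝ, t ∈ Ioo (-Real.pi) Real.pi →
      (r : ℂ) * Complex.exp (t * Complex.I) ∉ A := by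
  have hsymm : ∀ p : ℝ × ℝ, Complex.polarCoord.symm p = p.1 * Complex.exp (p.2 * Complex.I) := by
    intro p
    rw [Complex.polarCoord_symm_apply, Complex.exp_mul_I, Complex.ofReal_cos, Complex.ofReal_sin]
  have hcont : Continuous fun p : ℝ × ℝ => (p.1 : ℂ) * Complex.exp (p.2 * Complex.I) := by fun_prop
  set S : Set (ℝ × ℝ) := {p | p ∈ polarCoord.target ∧ (p.1 : ℂ) * Complex.exp (p.2 * Complex.I) ∈ A}
    with hS
  have hSm : MeasurableSet S :=
    polarCoord.open_target.measurableSet.inter (hcont.measurable hA)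
  have h1 : (∀ᵐ z, z ∉ A) ↔ (volume : Measure ℂ) A = 0 := by
    rw [ae_iff]; simp
  rw [h1, ← lintegral_indicator_one hA, ← Complex.lintegral_comp_polarCoord_symm]
  simp_rw [hsymm]
  have hFm : Measurable fun p : ℝ × ℝ => ENNReal.ofReal p.1 •
      A.indicator (1 : ℂ → ENNReal) (p.1 * Complex.exp (p.2 * Complex.I)) :=
    Measurable.smul (f := fun p : ℝ × ℝ => ENNReal.ofReal p.1) (by fun_prop)
      ((measurable_one.indicator hA).comp hcont.measurable)
  rw [setLIntegral_eq_zero_iff polarCoord.open_target.measurableSet hFm]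
  have h2 : (∀ᵐ p : ℝ × ℝ, p ∈ polarCoord.target → ENNReal.ofReal p.1 •
      A.indicator (1 : ℂ → ENNReal) (p.1 * Complex.exp (p.2 * Complex.I)) = 0) ↔
      (volume : Measure (ℝ × ℝ)) S = 0 := by
    rw [measure_eq_zero_iff_ae_notMem]
    refine eventually_congr (Eventually.of_forall fun p => ?_)
    simp only [hS, mem_ofPred_eq, not_and, smul_eq_mul, mul_eq_zero, ENNReal.ofReal_eq_zero]
    refine forall_congr' fun hp => ?_
    have : ¬ p.1 ≤ 0 := not_le.2 hp.1
    simp [this]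
  rw [h2, Measure.volume_eq_prod, Measure.measure_prod_null hSm]
  refine eventually_congr (Eventually.of_forall fun r => ?_)
  rw [Pi.zero_apply, measure_eq_zero_iff_ae_notMem, ← eventually_imp_distrib_left]
  refine eventually_congr (Eventually.of_forall fun t => ?_)
  simp only [hS, polarCoord_target, mem_preimage, mem_ofPred_eq, mem_prod, mem_Ioi, mem_Ioo]
  tauto

/-- A property that holds almost everywhere on the line holds almost everywhere after all
translations and reflections by a countable family of centres. -/
theorem ae_forall_comp {P : ℝ → Prop} (h : ∀ᵐ t, P t) {ι : Type*} [Countable ι] (c : ι → ℝ) :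
    ∀ᵐ t, ∀ i, P (c i + t) ∧ P (c i - t) := by
  refine ae_all_iff.2 fun i => ?_
  exact ((measurePreserving_add_left volume (c i)).quasiMeasurePreserving.ae h).and
    ((Measure.measurePreserving_sub_left volume (c i)).quasiMeasurePreserving.ae h)

section foldPt

variable {a : ℂ} {β α : ℝ}

theorem exp_add_int_mul_two_pi_mul_I (t : ℝ) (n : ℤ) :
    Complex.exp ((t + n * (2 * Real.pi) : ℝ) * Complex.I) = Complex.exp (t * Complex.I) := by
  rw [Complex.exp_eq_exp_iff_exists_int]
  exact ⟨n, by push_cast; ring⟩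

theorem ae_foldPt_notMem (hα : 0 < α) {N : Set ℂ} (hN : MeasurableSet N) (hN0 : volume N = 0) :
    ∀ᵐ r : ℝ, 0 < r → ∀ᵐ x : ℝ, foldPt a β α r x ∉ N := by
  have h0 : ∀ᵐ z : ℂ, z ∉ (fun z => a + z) ⁻¹' N :=
    (measurePreserving_add_left volume a).quasiMeasurePreserving.ae
      (measure_eq_zero_iff_ae_notMem.1 hN0)
  rw [ae_notMem_iff_polar (hN.preimage (measurable_const_add a))] at h0
  filter_upwards [h0] with r hr hr0
  have hP : ∀ᵐ t : ℝ, a + r * Complex.exp (t * Complex.I) ∉ N := by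
    have hne : ∀ᵐ t : ℝ, t ∉ range fun n : ℤ => Real.pi - n * (2 * Real.pi) :=
      (countable_range _).ae_notMem _
    filter_upwards [ae_forall_comp (hr hr0) fun n : ℤ => n * (2 * Real.pi), hne] with t ht htne
    obtain ⟨n, hn, -⟩ := existsUnique_add_zsmul_mem_Ioc Real.two_pi_pos t (-Real.pi)
    rw [zsmul_eq_mul] at hn
    have hlt : t + n * (2 * Real.pi) < Real.pi := by
      refine lt_of_le_of_ne (by linarith [hn.2]) fun h => htne ⟨n, ?_⟩
      linarith
    have := (ht n).1 ⟨by linarith [hn.1], by linarith⟩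
    rwa [add_comm _ t, exp_add_int_mul_two_pi_mul_I] at this
  -- Folding is, at each `x`, a translation or a reflection from a countable family, each of which
  -- preserves null sets.
  filter_upwards [ae_forall_comp hP fun q : ℤ × ℤ => β + q.1 * (2 * α)] with x hx
  obtain ⟨j, hj | hj⟩ := exists_eq_of_triangleWave hα x
  · have := (hx (-j, 0)).1
    rw [foldPt, hj]
    convert this using 5
    push_cast; ring
  · have := (hx (j, 0)).2
    rw [foldPt, hj]
    convert this using 5
    push_cast; ring

theorem ae_notMem_of_ae_foldPt (hα : 0 < α) {A : Set ℂ} (hA : MeasurableSet A)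
    (hAC : A ⊆ planarCone a β α) (h : ∀ᵐ r : ℝ, 0 < r → ∀ᵐ x : ℝ, foldPt a β α r x ∉ A) :
    volume A = 0 := by
  have h0 : ∀ᵐ z : ℂ, z ∉ (fun z => a + z) ⁻¹' A := by
    rw [ae_notMem_iff_polar (hA.preimage (measurable_const_add a))]
    filter_upwards [h] with r hr hr0
    filter_upwards [ae_forall_comp (hr hr0) fun n : ℤ => n * (2 * Real.pi) - β] with t ht _ htA
    obtain ⟨r', t', hr', h1, h2, heq⟩ := hAC htA
    obtain ⟨-, n, hn⟩ := eq_of_polar_eq hr' hr0 (add_left_cancel heq).symm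
    refine (ht n).1 ?_
    have hx : n * (2 * Real.pi) - β + t = t' - β := by linarith
    have habs : |t' - β - 2 * (0 : ℤ) * α| = t' - β := by
      rw [Int.cast_zero, mul_zero, zero_mul, sub_zero, abs_of_pos (by linarith)]
    rw [hx, foldPt, triangleWave_eq_abs hα 0 (by rw [habs]; linarith), habs, add_sub_cancel, hn,
      exp_add_int_mul_two_pi_mul_I]
    exact htA
  have h1 := (measurePreserving_add_left (volume : Measure ℂ) (-a)).quasiMeasurePreserving.ae h0
  rw [measure_eq_zero_iff_ae_notMem]
  filter_upwards [h1] with z hz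
  simpa using hz

/-- A null set of radii gives a null union of circles in the `(d, s)` plane, and almost all of its
slices are null by Fubini. -/
theorem ae_ae_sqrt {P : ℝ → Prop} (h : ∀ᵐ r : ℝ, 0 < r → P r) :
    ∀ᵐ d : ℝ, 0 < d → ∀ᵐ s : ℝ, P √(d ^ 2 + s ^ 2) := by
  set Z := toMeasurable volume {r : ℝ | ¬ (0 < r → P r)} with hZ
  have hZ0 : ∀ᵐ r : ℝ, r ∉ Z := by
    rw [← measure_eq_zero_iff_ae_notMem, hZ, measure_toMeasurable]
    exact ae_iff.1 h
  have hZm : MeasurableSet Z := measurableSet_toMeasurable _ _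
  have h1 : ∀ᵐ z : ℂ, z ∉ (fun z => ‖z‖) ⁻¹' Z := by
    rw [ae_notMem_iff_polar (hZm.preimage measurable_norm)]
    filter_upwards [hZ0] with r hr hr0
    refine Eventually.of_forall fun t _ => ?_
    rwa [mem_preimage, norm_mul, Complex.norm_exp_ofReal_mul_I, Complex.norm_real, mul_one,
      Real.norm_of_nonneg hr0.le]
  have h2 := Complex.volume_preserving_equiv_real_prod.symm.quasiMeasurePreserving.ae h1
  filter_upwards [Measure.ae_ae_of_ae_prod h2] with d hd hd0
  filter_upwards [hd] with s hs
  have hnorm : ‖Complex.measurableEquivRealProd.symm (d, s)‖ = √(d ^ 2 + s ^ 2) := by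
    rw [Complex.norm_def, Complex.normSq_apply]
    simp [sq]
  rw [mem_preimage, hnorm] at hs
  by_contra hP
  exact hs (subset_toMeasurable _ _ fun hcon => hP (hcon (sqrt_add_sq_pos hd0 s)))

theorem ae_foldedLine_notMem (hα : 0 < α) {N : Set ℂ} (hN : MeasurableSet N) (hN0 : volume N = 0) :
    ∀ᵐ d : ℝ, 0 < d → ∀ᵐ x : ℝ, ∀ᵐ s : ℝ, foldedLine a β α d x s ∉ N := by
  filter_upwards [ae_ae_sqrt (ae_foldPt_notMem (a := a) (β := β) hα hN hN0)] with d hd hd0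
  have hm : MeasurableSet {p : ℝ × ℝ | foldedLine a β α d p.2 p.1 ∉ N} := by
    have : Continuous fun p : ℝ × ℝ => foldedLine a β α d p.2 p.1 :=
      (continuous_foldPt a β α).comp
        (f := fun p : ℝ × ℝ => (√(d ^ 2 + p.1 ^ 2), p.2 + Real.arctan (p.1 / d))) (by fun_prop)
    exact this.measurable hN.compl
  -- For fixed `s` the angle is a translate of `x`, so the null set is easier to see in `x` first.
  rw [← Measure.ae_ae_comm (p := fun s x => foldedLine a β α d x s ∉ N) hm]
  filter_upwards [hd hd0] with s hs
  exact (measurePreserving_add_right volume (Real.arctan (s / d))).quasiMeasurePreserving.ae hs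

/-- Almost every folded line at a given distance avoids a given countable set. -/
theorem ae_forall_foldedLine_notMem (hα : 0 < α) {X : Set ℂ} (hX : X.Countable) {d : ℝ}
    (hd : 0 < d) : ∀ᵐ x : ℝ, ∀ s, foldedLine a β α d x s ∉ X := by
  -- These are all `x` whose line can pass through `p`: the radius fixes `s` up to sign, and the
  -- polar angle fixes `x + arctan (s / d)` up to sign, multiples of `2α` and multiples of `2π`.
  set w : ℂ → ℤ × ℤ × ℤˣ × ℤˣ → ℝ := fun p q =>
    2 * q.1 * α + ((q.2.2.1 : ℤ) : ℝ) * ((p - a).arg - β + q.2.1 * (2 * Real.pi)) -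
      Real.arctan (((q.2.2.2 : ℤ) : ℝ) * √(‖p - a‖ ^ 2 - d ^ 2) / d) with hw
  have hc : (⋃ p ∈ X, range (w p)).Countable := hX.biUnion fun p _ => countable_range _
  filter_upwards [hc.ae_notMem volume] with x hx s hs
  set p := foldedLine a β α d x s with hp
  refine hx (mem_iUnion₂.2 ⟨p, hs, ?_⟩)
  have hr := sqrt_add_sq_pos hd s
  have hnorm : ‖p - a‖ = √(d ^ 2 + s ^ 2) := by
    rw [hp, foldedLine, norm_foldPt_sub, abs_of_pos hr]
  have hpol : ((‖p - a‖ : ℝ) : ℂ) * Complex.exp ((p - a).arg * Complex.I) =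
      (√(d ^ 2 + s ^ 2) : ℝ) * Complex.exp
        ((β + triangleWave α (x + Real.arctan (s / d)) : ℝ) * Complex.I) := by
    rw [Complex.norm_mul_exp_arg_mul_I, hp, foldedLine, foldPt, add_sub_cancel_left]
  obtain ⟨-, n, hn⟩ := eq_of_polar_eq (hnorm ▸ hr) hr hpol
  have hs2 : √(‖p - a‖ ^ 2 - d ^ 2) = |s| := by
    rw [hnorm, Real.sq_sqrt (by positivity), add_sub_cancel_left, Real.sqrt_sq_eq_abs]
  obtain ⟨τ, hτ⟩ : ∃ τ : ℤˣ, ((τ : ℤ) : ℝ) * √(‖p - a‖ ^ 2 - d ^ 2) = s := by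
    rw [hs2]
    rcases abs_choice s with h | h
    · exact ⟨1, by simp [h]⟩
    · exact ⟨-1, by simp [h]⟩
  obtain ⟨j, hj | hj⟩ := exists_eq_of_triangleWave hα (x + Real.arctan (s / d))
  · refine ⟨(j, -n, 1, τ), ?_⟩
    simp only [hw, hτ]
    push_cast
    linarith
  · refine ⟨(j, -n, -1, τ), ?_⟩
    simp only [hw, hτ]
    push_cast
    linarith

end foldPt

/-! ### Piecewise continuous functions and the conclusion. -/

/-- A piecewise continuous function on a bounded set is continuous and bounded on an open subset of
full measure. -/
theorem IsPiecewiseContinuous.exists_continuousOn {f : ℂ → ℝ} {Ω : Set ℂ}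
    (hf : IsPiecewiseContinuous f Ω) (hΩ : Bornology.IsBounded Ω) :
    ∃ W, IsOpen W ∧ W ⊆ Ω ∧ volume (Ω \ W) = 0 ∧ ContinuousOn f W ∧ ∃ K, ∀ z ∈ W, |f z| ≤ K := by
  obtain ⟨n, U, hUo, hUΩ, -, hU0, hU⟩ := hf
  choose g hgc hg using hU
  have hK : ∀ i, ∃ K, ∀ z ∈ U i, |f z| ≤ K := by
    intro i
    obtain ⟨K, hK⟩ := (hΩ.subset (hUΩ i)).isCompact_closure.exists_bound_of_continuousOn (hgc i)
    exact ⟨K, fun z hz => by rw [hg i hz]; exact hK z (subset_closure hz)⟩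
  choose K hK using hK
  refine ⟨⋃ i, U i, isOpen_iUnion hUo, iUnion_subset hUΩ, hU0, ?_, ∑ i, |K i|, ?_⟩
  · intro z hz
    obtain ⟨i, hi⟩ := mem_iUnion.1 hz
    have hnhds := (hUo i).mem_nhds hi
    have h1 : ContinuousAt (g i) z :=
      ((hgc i).mono subset_closure).continuousAt hnhds
    exact (h1.congr (eventuallyEq_of_mem hnhds (hg i).symm)).continuousWithinAt
  · intro z hz
    obtain ⟨i, hi⟩ := mem_iUnion.1 hz
    exact (hK i z hi).trans ((le_abs_self _).trans
      (Finset.single_le_sum (f := fun i => |K i|) (fun _ _ => abs_nonneg _) (Finset.mem_univ i)))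

theorem ContinuousOn.measurable_indicator {f : ℂ → ℝ} {W : Set ℂ} (hf : ContinuousOn f W)
    (hW : MeasurableSet W) : Measurable (W.indicator f) := by
  classical
  rw [← piecewise_eq_indicator]
  exact hf.measurable_piecewise continuousOn_const hW

/-- Different values at `x` would persist on a nonempty open subset of `Ω`, which has positive
measure. -/
theorem eq_of_ae_eq_of_continuousWithinAt {f g : ℂ → ℝ} {Ω : Set ℂ} (hΩ : IsOpen Ω)
    (h : f =ᵐ[volume.restrict Ω] g) {x : ℂ} (hx : x ∈ closure Ω)
    (hf : ContinuousWithinAt f (closure Ω) x) (hg : ContinuousWithinAt g (closure Ω) x) :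
    f x = g x := by
  by_contra hne
  have hev : ∀ᶠ y in 𝓝[Ω] x, f y ≠ g y :=
    ((hf.mono subset_closure).prodMk (hg.mono subset_closure)).eventually
      ((isOpen_ne_fun continuous_fst continuous_snd).mem_nhds (x := (f x, g x)) hne)
  rw [eventually_nhdsWithin_iff] at hev
  obtain ⟨V, hV, hVo, hxV⟩ := eventually_nhds_iff.1 hev
  have hne' : (V ∩ Ω).Nonempty := mem_closure_iff.1 hx V hVo hxV
  have hpos := (hVo.inter hΩ).measure_pos volume hne'
  rw [Filter.EventuallyEq, ae_restrict_iff' hΩ.measurableSet] at h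
  refine hpos.ne' (measure_mono_null (fun y hy => ?_) (ae_iff.1 h))
  exact fun hcon => hV y hy.1 hy.2 (hcon hy.2)

theorem mainTheorem4 (a : ℂ) (β α : ℝ) (hα : 0 < α) (hα' : α ≤ 2 * Real.pi)
    (Ω R : Set ℂ) (hΩ_open : IsOpen Ω) (hΩ_conn : IsConnected Ω)
    (hΩ_bdd : Bornology.IsBounded Ω) (hΩ_cone : Ω ⊆ planarCone a β α)
    (hR : R ⊆ frontier Ω) (hR_cone : R ⊆ frontier (planarCone a β α))
    (hR_normal : {p ∈ R | ¬ ∃ ν : ℂ, IsOuterUnitNormal Ω p ν}.Countable)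
    (f g : ℂ → ℝ) (hf : IsPiecewiseContinuous f Ω) (hg : IsPiecewiseContinuous g Ω)
    (hfg : ∀ (L : ℝ) (γ : ℝ → ℂ), IsBrokenRay Ω R L γ →
      IntegrableAlong f L γ → IntegrableAlong g L γ →
      brokenRayTransform f L γ = brokenRayTransform g L γ) :
    f =ᵐ[volume.restrict Ω] g ∧
    ∀ x ∈ closure Ω, ContinuousWithinAt f (closure Ω) x → ContinuousWithinAt g (closure Ω) x →
      f x = g x := by
  obtain ⟨W₁, hW₁o, hW₁Ω, hW₁0, hfc, K₁, hK₁⟩ := hf.exists_continuousOn hΩ_bdd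
  obtain ⟨W₂, hW₂o, hW₂Ω, hW₂0, hgc, K₂, hK₂⟩ := hg.exists_continuousOn hΩ_bdd
  set W := W₁ ∩ W₂ with hW
  have hWo : IsOpen W := hW₁o.inter hW₂o
  have hWΩ : W ⊆ Ω := inter_subset_left.trans hW₁Ω
  have hW0 : volume (Ω \ W) = 0 := by
    rw [hW, sdiff_inter]
    exact measure_union_null hW₁0 hW₂0
  have hfm := (hfc.mono inter_subset_left : ContinuousOn f W).measurable_indicator hWo.measurableSet
  have hgm := (hgc.mono inter_subset_right : ContinuousOn g W).measurable_indicator hWo.measurableSet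
  have hbound : ∀ {f : ℂ → ℝ} {K : ℝ}, (∀ z ∈ W, |f z| ≤ K) → ∀ K', |K| ≤ K' →
      ∀ z, |W.indicator f z| ≤ K' := by
    intro f K hK K' hKK z
    by_cases hz : z ∈ W
    · rw [indicator_of_mem hz]
      exact (hK z hz).trans ((le_abs_self K).trans hKK)
    · rw [indicator_of_notMem hz, abs_zero]
      exact (abs_nonneg K).trans hKK
  have hfK := hbound (fun z hz => hK₁ z hz.1) (max |K₁| |K₂|) (le_max_left _ _)
  have hgK := hbound (fun z hz => hK₂ z hz.2) (max |K₁| |K₂|) (le_max_right _ _)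
  set h : ℂ → ℝ := fun z => W.indicator f z - W.indicator g z with hh
  have hm : Measurable h := hfm.sub hgm
  obtain ⟨M, hM⟩ := hΩ_bdd.subset_closedBall a
  -- The lift of `h` to the doubled sector: a function on the cone of angle `2 * α`, even in the
  -- angle.
  have hzero := ae_eq_zero_of_xray_cone_eq_zero (H := fun r x => h (foldPt a β α r x))
    (T := 2 * α) (C := max |K₁| |K₂| + max |K₁| |K₂|) (M := M) (by linarith)
    (hm.comp (continuous_foldPt a β α).measurable)
    (fun r x => (abs_sub _ _).trans (add_le_add (hfK _) (hgK _))) ?_ ?_ ?_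
  · have hA0 : volume {z | h z ≠ 0} = 0 := by
      refine ae_notMem_of_ae_foldPt (a := a) (β := β) hα (hm (measurableSet_singleton 0).compl) ?_ ?_
      · intro z hz
        by_contra hcon
        have : z ∉ W := fun hzW => hcon (hΩ_cone (hWΩ hzW))
        exact hz (by simp [hh, this])
      · filter_upwards [hzero] with r hr hr0
        filter_upwards [hr hr0] with x hx using not_not.2 hx
    have hae : f =ᵐ[volume.restrict Ω] g := by
      rw [Filter.EventuallyEq, ae_restrict_iff' hΩ_open.measurableSet]
      filter_upwards [measure_eq_zero_iff_ae_notMem.1 hA0, measure_eq_zero_iff_ae_notMem.1 hW0]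
        with z hz hzW hzΩ
      have hzW' : z ∈ W := by
        by_contra hcon
        exact hzW ⟨hzΩ, hcon⟩
      have hz0 : h z = 0 := not_not.1 hz
      simp only [hh, indicator_of_mem hzW'] at hz0
      linarith
    exact ⟨hae, fun x hx hfx hgx => eq_of_ae_eq_of_continuousWithinAt hΩ_open hae hx hfx hgx⟩
  · intro r x hr
    have : foldPt a β α r x ∉ W := by
      intro hmem
      have h1 := hM (hWΩ hmem)
      rw [Metric.mem_closedBall, dist_eq_norm, norm_foldPt_sub] at h1
      exact absurd (h1.trans_lt hr) (not_lt.2 (le_abs_self r))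
    simp [hh, this]
  · intro r x
    simp only [foldPt, triangleWave_periodic hα x]
  · filter_upwards [ae_foldedLine_notMem (a := a) (β := β) hα
      (hΩ_open.measurableSet.diff hWo.measurableSet) hW0] with d hd hd0
    filter_upwards [hd hd0, ae_forall_foldedLine_notMem (a := a) (β := β) hα hR_normal hd0]
      with x hN hx
    refine integral_foldedLine_eq_zero hα hα' hd0 hΩ_open hΩ_bdd hΩ_cone hR hR_cone hWΩ hfm hgm
      hfK hgK hfg (fun s hs => ?_) hN
    by_contra hcon
    exact hx s ⟨hs, hcon⟩
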